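/- Rings are associative with identity and all modules are right modules. A module is called CS if each of its submodules is essential in a direct summand, and its socle is the sum of its simple submodules. A right $R$-module satisfies $(*)$ if it is a direct sum $A\oplus B$ where $A$ is CS or noetherian and $B$ is projective. A subfactor of $M$ is a module $N/K$ with $K\subseteq N$ submodules of $M$. The ring $R$ is a right V-ring if every simple right $R$-module is injective, and a right WV-ring if every simple right $R$-module is $R/I$-injective for every right ideal $I$ of $R$ with $R/I\not\cong R$ as right modules. (Here $Q$ is $N$-injective if every homomorphism from a submodule of $N$ to $Q$ extends to $N$.) Theorem. (a) Let $R$ be a right V-ring and let $M$ be a finitely generated right $R$-module with projective socle such that every cyclic subfactor of $M$ satisfies $(*)$. Then $M$ is noetherian, and $M=X\oplus T$ with $X$ semisimple and $T$ noetherian with zero socle. In particular, if $R$ is a right V-ring such that every cyclic right $R$-module satisfies $(*)$, then there is a ring decomposition $R\cong S\times T$ where $S$ is a semisimple artinian ring (possibly zero) and $T$ is a finite (possibly empty) direct product of simple right noetherian rings, each with zero right socle. (b) A right WV-ring $R$ is right noetherian if and only if every cyclic right $R$-module satisfies $(*)$. -/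

import Mathlib

/-! Right `R`-modules are modules over `Rᵐᵒᵖ`; the notions below are defined for left modules over an
arbitrary ring `A` and used with `A = Rᵐᵒᵖ`. In particular right ideals of `R` are the submodules
of `R` over `Rᵐᵒᵖ`. -/

universe u v w

namespace RightMod

section Modules

variable (A : Type u) [Ring A] (M : Type v) [AddCommGroup M] [Module A M]

/-- The socle of `M`: the sum of all simple submodules. -/
def socle : Submodule A M :=
  sSup {N : Submodule A M | IsSimpleModule A N}

/-- `M` is cyclic, i.e. generated by one element. -/
def IsCyclicModule : Prop :=
  ∃ x : M, Submodule.span A {x} = ⊤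

variable {A M} in
/-- `N` is an essential submodule of `K`: it is contained in `K` and meets every nonzero
submodule of `K` nontrivially. -/
def IsEssentialIn (N K : Submodule A M) : Prop :=
  N ≤ K ∧ ∀ L : Submodule A M, L ≤ K → L ≠ ⊥ → N ⊓ L ≠ ⊥

/-- `M` is a CS module (extending module): every submodule is essential in a direct summand. -/
def IsCSModule : Prop :=
  ∀ N : Submodule A M, ∃ K L : Submodule A M, IsCompl K L ∧ IsEssentialIn N K

/-- Property (*): `M = C ⊕ P` with `C` CS or noetherian and `P` projective. -/
def SatisfiesStar : Prop :=
  ∃ C P : Submodule A M, IsCompl C P ∧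
    (IsCSModule A C ∨ IsNoetherian A C) ∧ Module.Projective A P

/-- Every cyclic subfactor of `M` satisfies (*). -/
def CyclicSubfactorsSatisfyStar : Prop :=
  ∀ (N : Submodule A M) (K : Submodule A N), IsCyclicModule A (N ⧸ K) → SatisfiesStar A (N ⧸ K)

/-- `Q` is injective relative to `M`: homomorphisms from submodules of `M` into `Q` extend
to `M`. -/
def IsInjectiveRelativeTo (Q : Type w) [AddCommGroup Q] [Module A Q] : Prop :=
  ∀ (N : Submodule A M) (f : N →ₗ[A] Q), ∃ g : M →ₗ[A] Q, ∀ x : N, g x = f x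

end Modules

section Rings

variable (R : Type u) [Ring R]

/-- Right V-ring: every simple right module is injective. -/
def IsRightVRing : Prop :=
  ∀ (Q : Type u) [AddCommGroup Q] [Module Rᵐᵒᵖ Q],
    IsSimpleModule Rᵐᵒᵖ Q → Module.Injective Rᵐᵒᵖ Q

/-- Right WV-ring: every simple right module is `R/I`-injective for every right ideal `I` such
that `R/I` is not isomorphic to `R` as a right module. -/
def IsRightWVRing : Prop :=
  ∀ (Q : Type u) [AddCommGroup Q] [Module Rᵐᵒᵖ Q], IsSimpleModule Rᵐᵒᵖ Q →
    ∀ I : Submodule Rᵐᵒᵖ R, IsEmpty ((R ⧸ I) ≃ₗ[Rᵐᵒᵖ] R) →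
      IsInjectiveRelativeTo Rᵐᵒᵖ (R ⧸ I) Q

/-- Every cyclic right `R`-module satisfies (*). -/
def CyclicRightModulesSatisfyStar : Prop :=
  ∀ (N : Type u) [AddCommGroup N] [Module Rᵐᵒᵖ N],
    IsCyclicModule Rᵐᵒᵖ N → SatisfiesStar Rᵐᵒᵖ N

end Rings

end RightMod

/-! Call maximal submodules separating if every submodule is an intersection of maximal ones
(`CoatomsSeparate`). This holds for all modules over a V-ring and, over a WV-ring, for `R ⧸ E` with
`E` essential. Everything noetherian follows from `SubfactorsStar.isNoetherian`, for a cyclic module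
`M` with (*) on cyclic subfactors.

If `E` is essential in `M`, a projective summand of a cyclic subfactor of `M ⧸ E` lifts to a
submodule of `M` missing `E`, so it is zero; cyclic subfactors of `M ⧸ E` are thus CS or noetherian.
An Osofsky–Smith argument makes their socles finitely generated, and Shock's criterion makes `M ⧸ E`
noetherian. Letting `E` vary, `M ⧸ socle A M` is noetherian. If the socle were not finitely
generated, (*) would split `M` into two summands of the same kind; splitting repeatedly contradicts
the ascending chain condition modulo the socle. So `M` is noetherian. A finitely generated socle
then splits off by separation.

For the ring decomposition, separation makes `R` semiprime and its two-sided ideals idempotent. With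
the noetherian condition they are generated by central idempotents, finitely many maximal ones meet
in zero, and the Chinese remainder theorem gives simple factors, which are semisimple unless their
right socle vanishes. -/

namespace RightMod

/-! ### Essential extensions and independent families -/

section Essential

variable {A : Type u} [Ring A] {M : Type v} [AddCommGroup M] [Module A M]

/-- Every nonzero element of `K` has a nonzero multiple in `N`. -/
def MeetsAll (N K : Submodule A M) : Prop :=
  ∀ x ∈ K, x ≠ 0 → ∃ a : A, a • x ≠ 0 ∧ a • x ∈ N

theorem MeetsAll.of_disjoint {N K : Submodule A M}
    (h : ∀ L ≤ K, Disjoint N L → L = ⊥) : MeetsAll N K := by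
  intro x hx hx0
  by_contra! hc
  have : Submodule.span A {x} = ⊥ := by
    refine h _ (by simpa using hx) ?_
    rw [Submodule.disjoint_def]
    intro y hy hyx
    obtain ⟨a, rfl⟩ := Submodule.mem_span_singleton.1 hyx
    by_contra h0
    exact hc a h0 hy
  exact hx0 (by simpa using this)

theorem MeetsAll.eq_bot {N K L : Submodule A M} (h : MeetsAll N K) (hL : L ≤ K)
    (hd : Disjoint N L) : L = ⊥ := by
  rw [eq_bot_iff]
  intro x hx
  by_contra h0
  obtain ⟨a, ha, haN⟩ := h x (hL hx) h0
  exact ha (Submodule.disjoint_def.1 hd _ haN (L.smul_mem a hx))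

theorem IsEssentialIn.meetsAll {N K : Submodule A M} (h : IsEssentialIn N K) : MeetsAll N K := by
  refine .of_disjoint fun L hL hd => ?_
  by_contra h0
  exact h.2 L hL h0 hd.eq_bot

theorem MeetsAll.mono {N K L : Submodule A M} (h : MeetsAll N K) (hL : L ≤ K) : MeetsAll N L :=
  fun x hx => h x (hL hx)

theorem MeetsAll.inf {N K L : Submodule A M} (h : MeetsAll N K) (hL : L ≤ K) :
    MeetsAll (N ⊓ L) L := by
  intro x hx h0
  obtain ⟨a, ha, haN⟩ := h x (hL hx) h0
  exact ⟨a, ha, haN, L.smul_mem a hx⟩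

/-- A submodule together with a complement relative to intersection is essential. -/
theorem exists_disjoint_meetsAll (N : Submodule A M) :
    ∃ C : Submodule A M, Disjoint N C ∧ MeetsAll (N ⊔ C) ⊤ := by
  obtain ⟨C, hC⟩ := zorn_le (α := {C : Submodule A M // Disjoint N C}) fun c hc =>
    ⟨⟨sSup (Subtype.val '' c), by
      rw [DirectedOn.disjoint_sSup_right]
      · rintro _ ⟨C, -, rfl⟩
        exact C.2
      · rw [directedOn_image]
        exact hc.directedOn⟩,
     fun C hCc => le_sSup (Set.mem_image_of_mem Subtype.val hCc)⟩
  refine ⟨C.1, C.2, .of_disjoint fun L _ hd => ?_⟩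
  have h1 : Disjoint N (C.1 ⊔ L) := C.2.disjoint_sup_right_of_disjoint_sup_left hd
  have h2 : C.1 ⊔ L ≤ C.1 := hC (b := ⟨_, h1⟩) (show C.1 ≤ C.1 ⊔ L from le_sup_left)
  exact hd.eq_bot_of_ge ((le_sup_right.trans h2).trans le_sup_right)

variable {ι : Type*}

/-- Induction on `s`: one multiplier brings the new component into `S j`, a second brings the rest
into its sum. The result stays nonzero because these two sums are disjoint. -/
theorem MeetsAll.finset_sup {S D : ι → Submodule A M} (hS : iSupIndep S)
    (h : ∀ i, MeetsAll (S i) (D i)) (s : Finset ι) :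
    MeetsAll (⨆ i ∈ s, S i) (⨆ i ∈ s, D i) := by
  classical
  induction s using Finset.induction_on with
  | empty => intro x hx; simp_all
  | insert j s hj ih =>
    rw [Finset.iSup_insert, Finset.iSup_insert]
    have hdis : Disjoint (S j) (⨆ i ∈ s, S i) := hS.disjoint_biSup (by simpa using hj)
    intro x hx hx0
    obtain ⟨c, hc, x', hx', rfl⟩ := Submodule.mem_sup.1 hx
    by_cases hc0 : c = 0
    · obtain ⟨a, ha, haS⟩ := ih x' hx' (by simpa [hc0] using hx0)
      exact ⟨a, by simpa [hc0] using ha, by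
        simpa [hc0] using Submodule.mem_sup_right haS⟩
    obtain ⟨a, ha, haS⟩ := h j c hc hc0
    by_cases hax : a • x' = 0
    · exact ⟨a, by simpa [hax] using ha, by simpa [hax] using Submodule.mem_sup_left haS⟩
    obtain ⟨b, hb, hbS⟩ := ih _ (Submodule.smul_mem _ a hx') hax
    refine ⟨b * a, fun h0 => hb ?_, ?_⟩
    · have h1 : b • a • x' ∈ S j := by
        have : b • a • x' = -(b • a • c) := by
          rw [mul_smul, smul_add, smul_add] at h0
          exact eq_neg_of_add_eq_zero_right h0
        rw [this]
        exact neg_mem (Submodule.smul_mem _ b haS)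
      exact Submodule.disjoint_def.1 hdis _ h1 hbS
    · rw [mul_smul, smul_add, smul_add]
      exact Submodule.add_mem_sup (Submodule.smul_mem _ b haS) hbS

theorem MeetsAll.iSup {S D : ι → Submodule A M} (hS : iSupIndep S)
    (h : ∀ i, MeetsAll (S i) (D i)) : MeetsAll (⨆ i, S i) (⨆ i, D i) := by
  intro x hx hx0
  obtain ⟨s, hs⟩ := Submodule.mem_iSup_iff_exists_finset.1 hx
  obtain ⟨a, ha, haS⟩ := MeetsAll.finset_sup hS h s x hs hx0
  exact ⟨a, ha, (iSup₂_le fun i _ => le_iSup S i) haS⟩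

/-- Essential extensions of independent submodules are independent. -/
theorem MeetsAll.iSupIndep {S D : ι → Submodule A M} (hS : iSupIndep S)
    (h : ∀ i, MeetsAll (S i) (D i)) : iSupIndep D := by
  classical
  rw [iSupIndep_iff_supIndep]
  intro t
  rw [Finset.supIndep_iff_disjoint_erase]
  intro i _
  rw [Finset.sup_eq_iSup, Submodule.disjoint_def]
  intro x hxi hx
  by_contra hx0
  obtain ⟨a, ha, haS⟩ := MeetsAll.finset_sup hS h _ x hx hx0
  obtain ⟨b, hb, hbS⟩ := h i _ ((D i).smul_mem a hxi) ha
  have hdis : Disjoint (S i) (⨆ j ∈ t.erase i, S j) :=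
    hS.disjoint_biSup (y := ↑(t.erase i)) (by simp)
  exact hb (Submodule.disjoint_def.1 hdis _ hbS (Submodule.smul_mem _ b haS))

/-- Independence passes to the images modulo `E` when `E` meets the sum in a graded submodule. -/
theorem iSupIndep_map_mkQ {S D : ι → Submodule A M} (hD : iSupIndep D) (hSD : ∀ i, S i ≤ D i)
    {E : Submodule A M} (hSE : ∀ i, S i ≤ E) (hE : E ⊓ ⨆ i, D i ≤ ⨆ i, S i) :
    iSupIndep fun i => (D i).map E.mkQ := by
  intro i
  have : (⨆ (j) (_ : j ≠ i), (D j).map E.mkQ) = (⨆ (j) (_ : j ≠ i), D j).map E.mkQ := by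
    simp_rw [Submodule.map_iSup]
  rw [this, Submodule.disjoint_def]
  rintro _ ⟨z, hz, rfl⟩ ⟨w, hw, hwz⟩
  have hzw : z - w ∈ E := by
    rw [← Submodule.ker_mkQ E, LinearMap.mem_ker, map_sub, hwz, sub_self]
  have hz' : z ∈ ⨆ i, D i := Submodule.mem_iSup_of_mem i hz
  have hw' : w ∈ ⨆ i, D i := (iSup₂_le fun j _ => le_iSup D j) hw
  have hS := hE ⟨hzw, sub_mem hz' hw'⟩
  have hsplit : (⨆ i, S i) ≤ S i ⊔ ⨆ (j) (_ : j ≠ i), S j := by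
    refine iSup_le fun j => ?_
    by_cases hj : j = i
    · subst hj; exact le_sup_left
    · exact le_sup_of_le_right (le_iSup₂_of_le j hj le_rfl)
  obtain ⟨s, hs, s', hs', hss⟩ := Submodule.mem_sup.1 (hsplit hS)
  have h1 : z - s ∈ D i := sub_mem hz (hSD i hs)
  have h2 : z - s ∈ ⨆ (j) (_ : j ≠ i), D j := by
    have : z - s = w + s' := by
      rw [sub_eq_iff_eq_add, add_assoc, add_comm s' s, hss]; abel
    rw [this]
    exact add_mem hw ((iSup₂_mono fun j _ => hSD j) hs')
  have h3 : z = s := sub_eq_zero.1 (Submodule.disjoint_def.1 (hD i) _ h1 h2)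
  rw [Submodule.mkQ_apply, Submodule.Quotient.mk_eq_zero, h3]
  exact hSE i hs

end Essential

/-! ### Semisimple submodules and the socle -/

section Semisimple

variable {A : Type u} [Ring A] {M : Type v} [AddCommGroup M] [Module A M]
variable {M' : Type w} [AddCommGroup M'] [Module A M']

theorem isSemisimple_of_le {N K : Submodule A M} (h : N ≤ K) (hK : IsSemisimpleModule A K) :
    IsSemisimpleModule A N :=
  .of_injective (Submodule.inclusion h) (Submodule.inclusion_injective h)

theorem isSemisimple_map {N : Submodule A M} (hN : IsSemisimpleModule A N) (f : M →ₗ[A] M') :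
    IsSemisimpleModule A (N.map f) :=
  .of_surjective (f.submoduleMap N) (f.submoduleMap_surjective N)

theorem isSemisimple_iSup {ι : Type*} {p : ι → Submodule A M}
    (hp : ∀ i, IsSemisimpleModule A (p i)) : IsSemisimpleModule A ↥(⨆ i, p i) := by
  have := isSemisimpleModule_biSup_of_isSemisimpleModule_submodule (s := Set.univ) (p := p)
    fun i _ => hp i
  rwa [iSup_univ] at this

theorem isSemisimple_socle : IsSemisimpleModule A (socle A M) := by
  rw [socle, sSup_eq_iSup]
  exact isSemisimpleModule_biSup_of_isSemisimpleModule_submodule fun N hN => by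
    have : IsSimpleModule A N := hN
    infer_instance

theorem le_socle_iff {N : Submodule A M} : N ≤ socle A M ↔ IsSemisimpleModule A N := by
  refine ⟨fun h => isSemisimple_of_le h isSemisimple_socle, fun h => ?_⟩
  rw [← Submodule.map_subtype_top N, ← IsSemisimpleModule.sSup_simples_eq_top A N, sSup_eq_iSup]
  simp_rw [Submodule.map_iSup]
  refine iSup₂_le fun S hS => le_sSup ?_
  have : IsSimpleModule A S := hS
  exact (Submodule.equivMapOfInjective _ N.injective_subtype S).symm.isSimpleModule_iff.2 hS

/-- A complement of `S` in `L` misses `S`, so essentiality makes it zero. -/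
theorem MeetsAll.eq_of_semisimple {S L : Submodule A M} (h : MeetsAll S L) (hSL : S ≤ L)
    (hL : IsSemisimpleModule A L) : S = L := by
  obtain ⟨C, hC⟩ := exists_isCompl (S.comap L.subtype)
  have h0 : C.map L.subtype = ⊥ := by
    refine h.eq_bot (Submodule.map_subtype_le _ _) ?_
    rw [Submodule.disjoint_def]
    rintro _ hx ⟨y, hy, rfl⟩
    have := Submodule.disjoint_def.1 hC.disjoint y hx hy
    simp [this]
  have hC0 : C = ⊥ := 
    Submodule.map_injective_of_injective L.injective_subtype (h0.trans (Submodule.map_bot _).symm)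
  have h1 := hC.sup_eq_top
  rw [hC0, sup_bot_eq, Submodule.comap_subtype_eq_top] at h1
  exact le_antisymm hSL h1

theorem MeetsAll.le_of_semisimple {S L : Submodule A M} (h : MeetsAll S L)
    (hL : IsSemisimpleModule A L) : L ≤ S :=
  inf_eq_right.1 ((h.inf le_rfl).eq_of_semisimple inf_le_right hL)

theorem iSupIndep_comap_subtype {ι : Type*} {T : ι → Submodule A M} (hT : iSupIndep T)
    (N : Submodule A M) : iSupIndep fun i => (T i).comap N.subtype := by
  intro i
  rw [Submodule.disjoint_def]
  intro x hx hx'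
  have : (⨆ (j) (_ : j ≠ i), (T j).comap N.subtype) ≤
      (⨆ (j) (_ : j ≠ i), T j).comap N.subtype :=
    iSup₂_le fun j hj => Submodule.comap_mono (le_iSup₂_of_le j hj le_rfl)
  exact Subtype.ext (Submodule.disjoint_def.1 (hT i) x hx (this hx'))

theorem not_isNoetherian_of_iSupIndep {ι : Type*} [Infinite ι] {T : ι → Submodule A M}
    (hT : iSupIndep T) (h0 : ∀ i, T i ≠ ⊥) {N : Submodule A M} (hN : ∀ i, T i ≤ N) :
    ¬ IsNoetherian A N := by
  intro _
  refine not_finite_iff_infinite.2 ‹Infinite ι›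
    (WellFoundedGT.finite_of_iSupIndep (iSupIndep_comap_subtype hT N) fun i h => h0 i ?_)
  rw [← inf_eq_right.2 (hN i), ← Submodule.map_comap_subtype, h, Submodule.map_bot]

/-- A semisimple submodule that is not finitely generated contains an independent sequence of
submodules that are not finitely generated. -/
theorem exists_iSupIndep_not_fg {S : Submodule A M} (hS : IsSemisimpleModule A S)
    (hfg : ¬ S.FG) : ∃ T : ℕ → Submodule A M, iSupIndep T ∧ ∀ k, T k ≤ S ∧ ¬ (T k).FG := by
  obtain ⟨s, hs, hsup, hsimple⟩ := IsSemisimpleModule.exists_sSupIndep_sSup_simples_eq_top A S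
  have hinf : s.Infinite := by
    intro hfin
    refine hfg (Module.Finite.iff_fg.1 ?_)
    exact ((IsSemisimpleModule.finite_tfae (R := A) (M := S)).out 0 4 rfl rfl).2
      ⟨s, hfin, hs, hsup, hsimple⟩
  have := hinf.to_subtype
  -- Infinitely many independent simples are arranged in an array; `T k` is the sum of row `k`.
  let e : ℕ × ℕ → s := fun p => Infinite.natEmbedding s (Nat.pairEquiv p)
  have he : Function.Injective e :=
    (Infinite.natEmbedding s).injective.comp Nat.pairEquiv.injective
  let f : ℕ × ℕ → Submodule A S := fun p => (e p).1
  have hf : iSupIndep f := ((sSupIndep_iff s).1 hs).comp he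
  let T : ℕ → Submodule A S := fun k => ⨆ p ∈ {p : ℕ × ℕ | p.1 = k}, f p
  have hT : iSupIndep T := by
    intro k
    have : (⨆ (j) (_ : j ≠ k), T j) ≤ ⨆ p ∈ {p : ℕ × ℕ | p.1 ≠ k}, f p :=
      iSup₂_le fun j hj => iSup₂_le fun p (hp : p.1 = j) =>
        le_iSup₂_of_le (f := fun p (_ : p ∈ {p : ℕ × ℕ | p.1 ≠ k}) => f p) p
          (fun h => hj (hp.symm.trans h)) le_rfl
    refine Disjoint.mono_right this (hf.disjoint_biSup_biSup ?_)
    exact Set.disjoint_left.2 fun p h1 h2 => h2 h1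
  have hTfg : ∀ k, ¬ (T k).FG := by
    intro k hk
    have : Module.Finite A (T k) := Module.Finite.iff_fg.2 hk
    have hle : ∀ i, f (k, i) ≤ T k := fun i =>
      le_iSup₂_of_le (f := fun p (_ : p ∈ {p : ℕ × ℕ | p.1 = k}) => f p) (k, i) rfl le_rfl
    have hne : ∀ i, f (k, i) ≠ ⊥ := fun i => by
      have : IsSimpleModule A (f (k, i)) := hsimple _ (e (k, i)).2
      exact (Submodule.nontrivial_iff_ne_bot).1 (IsSimpleModule.nontrivial A _)
    exact not_isNoetherian_of_iSupIndep (hf.comp (f := fun i : ℕ => (k, i))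
      fun i j h => by simpa using h) hne hle inferInstance
  refine ⟨fun k => (T k).map S.subtype, ?_, fun k => ⟨Submodule.map_subtype_le _ _, fun h => ?_⟩⟩
  · intro k
    simp_rw [← Submodule.map_iSup]
    exact (Submodule.disjoint_map S.injective_subtype (hT k))
  · exact hTfg k (Submodule.fg_of_fg_map_injective _ S.injective_subtype h)

/-- Every semisimple submodule is finitely generated. -/
def SemisimpleSubmodulesFG (A : Type u) [Ring A] (M : Type v) [AddCommGroup M] [Module A M] :
    Prop :=
  ∀ S : Submodule A M, IsSemisimpleModule A S → S.FG

theorem SemisimpleSubmodulesFG.of_injective (h : SemisimpleSubmodulesFG A M') (f : M →ₗ[A] M')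
    (hf : Function.Injective f) : SemisimpleSubmodulesFG A M := fun _ hS =>
  Submodule.fg_of_fg_map_injective f hf (h _ (isSemisimple_map hS f))

theorem SemisimpleSubmodulesFG.of_isNoetherian [IsNoetherian A M] :
    SemisimpleSubmodulesFG A M := fun _ _ => IsNoetherian.noetherian _

/-- If a map has image in a module with finitely generated semisimple submodules, and so does its
kernel, then so does its domain. -/
theorem SemisimpleSubmodulesFG.of_ker (f : M →ₗ[A] M') (h : SemisimpleSubmodulesFG A M')
    (hk : SemisimpleSubmodulesFG A (LinearMap.ker f)) : SemisimpleSubmodulesFG A M := by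
  intro S hS
  refine Submodule.fg_of_fg_map_of_fg_inf_ker f (h _ (isSemisimple_map hS f)) ?_
  have h1 : IsSemisimpleModule A ↥(S.comap (LinearMap.ker f).subtype) :=
    IsSemisimpleModule.of_injective
      (((LinearMap.ker f).subtype.comp (Submodule.subtype _)).codRestrict S fun x => x.2)
      fun x y hxy => by
        have := congrArg Subtype.val hxy
        exact Subtype.ext (Subtype.ext this)
  have h2 := (hk _ h1).map (LinearMap.ker f).subtype
  rwa [Submodule.map_comap_subtype, inf_comm] at h2

end Semisimple

/-! ### Cyclic modules and invariance under isomorphism -/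

section Cyclic

variable {A : Type u} [Ring A] {M : Type v} [AddCommGroup M] [Module A M]
variable {M' : Type w} [AddCommGroup M'] [Module A M']

theorem IsCyclicModule.of_surjective (h : IsCyclicModule A M) (f : M →ₗ[A] M')
    (hf : Function.Surjective f) : IsCyclicModule A M' := by
  obtain ⟨x, hx⟩ := h
  refine ⟨f x, ?_⟩
  rw [← Set.image_singleton, Submodule.span_image, hx, Submodule.map_top,
    LinearMap.range_eq_top.2 hf]

theorem IsCyclicModule.finite (h : IsCyclicModule A M) : Module.Finite A M := by
  obtain ⟨x, hx⟩ := h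
  exact ⟨⟨{x}, by simpa using hx⟩⟩

theorem isCyclicModule_span (x : M) : IsCyclicModule A (Submodule.span A {x}) := by
  refine ⟨⟨x, Submodule.mem_span_singleton_self x⟩, ?_⟩
  rw [eq_top_iff]
  rintro ⟨y, hy⟩ -
  obtain ⟨a, rfl⟩ := Submodule.mem_span_singleton.1 hy
  exact Submodule.mem_span_singleton.2 ⟨a, rfl⟩

theorem fg_of_isCompl [Module.Finite A M] {N K : Submodule A M} (h : IsCompl N K) : N.FG := by
  have := (Module.Finite.fg_top (R := A) (M := M)).map (N.projectionOnto K h)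
  rw [Submodule.map_top, Submodule.range_projectionOnto] at this
  simpa using this.map N.subtype

theorem IsCSModule.congr (h : IsCSModule A M) (e : M ≃ₗ[A] M') : IsCSModule A M' := by
  intro N
  obtain ⟨K, L, hKL, hN, hess⟩ := h (N.comap e.toLinearMap)
  refine ⟨K.map e.toLinearMap, L.map e.toLinearMap, ?_, ?_, ?_⟩
  · exact hKL.map (Submodule.orderIsoMapComap e)
  · have := Submodule.map_mono (f := e.toLinearMap) hN
    rwa [Submodule.map_comap_eq_of_surjective e.surjective] at this
  · intro X hX hX0 hd
    refine hess (X.comap e.toLinearMap) ?_ ?_ ?_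
    · have := Submodule.comap_mono (f := e.toLinearMap) hX
      rwa [Submodule.comap_map_eq_of_injective e.injective] at this
    · intro h0
      apply hX0
      rw [← Submodule.map_comap_eq_of_surjective e.surjective X]
      erw [h0]; exact Submodule.map_bot _
    · rw [← Submodule.comap_inf, hd]
      exact LinearMap.ker_eq_bot.2 e.injective

theorem SatisfiesStar.congr (h : SatisfiesStar A M) (e : M ≃ₗ[A] M') : SatisfiesStar A M' := by
  obtain ⟨C, P, hCP, hC, hP⟩ := h
  refine ⟨C.map e.toLinearMap, P.map e.toLinearMap, ?_, hC.imp (fun h => ?_) fun h => ?_, ?_⟩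
  · exact hCP.map (Submodule.orderIsoMapComap e)
  · exact h.congr (e.submoduleMap C)
  · have := h
    exact isNoetherian_of_linearEquiv (e.submoduleMap C)
  · exact Module.Projective.of_equiv (e.submoduleMap P)

end Cyclic

/-! ### Separation by maximal submodules and Shock's criterion -/

section Separation

variable {A : Type u} [Ring A] {M : Type v} [AddCommGroup M] [Module A M]

/-- Every submodule is an intersection of maximal submodules. -/
def CoatomsSeparate (A : Type u) [Ring A] (M : Type v) [AddCommGroup M] [Module A M] : Prop :=
  ∀ (N : Submodule A M) (x : M), x ∉ N → ∃ H, IsCoatom H ∧ N ≤ H ∧ x ∉ H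

theorem CoatomsSeparate.quotient (h : CoatomsSeparate A M) (K : Submodule A M) :
    CoatomsSeparate A (M ⧸ K) := by
  intro N x hx
  obtain ⟨m, rfl⟩ := K.mkQ_surjective x
  obtain ⟨H, hH, hNH, hmH⟩ := h (N.comap K.mkQ) m hx
  have hK : K ≤ H := (Submodule.le_comap_mkQ K N).trans hNH
  have hc : (H.map K.mkQ).comap K.mkQ = H := by
    rw [Submodule.comap_map_eq, Submodule.ker_mkQ, sup_eq_left.2 hK]
  refine ⟨H.map K.mkQ, Submodule.isCoatom_map_of_ker_le K.mkQ_surjective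
    (K.ker_mkQ.trans_le hK) hH, ?_, fun hm => hmH ?_⟩
  · rw [← Submodule.map_comap_eq_of_surjective K.mkQ_surjective N]
    exact Submodule.map_mono hNH
  · rw [← hc]; exact hm

/-- `S` is artinian, so some finite intersection of maximal submodules has minimal trace on `S`. A
nonzero element of that trace could be excluded by one more maximal submodule. -/
theorem CoatomsSeparate.exists_finset (h : CoatomsSeparate A M) {S : Submodule A M}
    (hS : IsSemisimpleModule A S) (hfg : S.FG) :
    ∃ F : Finset (Submodule A M), (∀ H ∈ F, IsCoatom H) ∧ Disjoint S (F.inf id) := by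
  classical
  have : Module.Finite A S := Module.Finite.iff_fg.2 hfg
  obtain ⟨N, ⟨F, hF, rfl⟩, hmin⟩ := (IsWellFounded.wf (r := ((· < ·) :
    Submodule A S → Submodule A S → Prop))).has_min
    {N | ∃ F : Finset (Submodule A M), (∀ H ∈ F, IsCoatom H) ∧ (F.inf id).comap S.subtype = N}
    ⟨_, ∅, by simp, rfl⟩
  refine ⟨F, hF, Submodule.disjoint_def.2 fun x hxS hxF => ?_⟩
  by_contra hx0
  obtain ⟨H, hH, -, hxH⟩ := h ⊥ x (by simpa using hx0)
  refine hmin _ ⟨insert H F, ?_, rfl⟩ ?_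
  · simpa using ⟨hH, hF⟩
  · rw [Finset.inf_insert]
    refine lt_of_le_of_ne (Submodule.comap_mono inf_le_right) fun heq => hxH ?_
    have : (⟨x, hxS⟩ : S) ∈ (F.inf id).comap S.subtype := hxF
    rw [← heq] at this
    exact this.1

theorem isSemisimple_of_disjoint_coatoms {L : Submodule A M} (F : Finset (Submodule A M))
    (hF : ∀ H ∈ F, IsCoatom H) (hL : Disjoint L (F.inf id)) : IsSemisimpleModule A L := by
  have : ∀ H : F, IsSimpleModule A (M ⧸ H.1) := fun H => isSimpleModule_iff_isCoatom.2 (hF _ H.2)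
  let φ : M →ₗ[A] ∀ H : F, M ⧸ H.1 := LinearMap.pi fun H => H.1.mkQ
  refine .of_injective (φ.comp L.subtype) ((injective_iff_map_eq_zero _).2 fun x hx => ?_)
  refine Subtype.ext (Submodule.disjoint_def.1 hL x x.2 ?_)
  rw [Submodule.mem_finsetInf]
  intro H hH
  exact (Submodule.Quotient.mk_eq_zero H).1 (congrFun hx ⟨H, hH⟩)

/-- A finitely generated semisimple submodule has no proper essential extension. -/
theorem CoatomsSeparate.le_of_meetsAll (h : CoatomsSeparate A M) {S L : Submodule A M}
    (hS : IsSemisimpleModule A S) (hfg : S.FG) (hL : MeetsAll S L) : L ≤ S := by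
  obtain ⟨F, hF, hd⟩ := h.exists_finset hS hfg
  refine hL.le_of_semisimple (isSemisimple_of_disjoint_coatoms F hF ?_)
  rw [disjoint_iff]
  exact hL.eq_bot inf_le_left (hd.mono_right inf_le_right)

/-- Some map from `M` to a finite product of simple modules is injective on `S`. The image of `S`
has a complement there, whose preimage complements `S`. -/
theorem CoatomsSeparate.exists_isCompl (h : CoatomsSeparate A M) {S : Submodule A M}
    (hS : IsSemisimpleModule A S) (hfg : S.FG) : ∃ T, IsCompl S T := by
  obtain ⟨F, hF, hd⟩ := h.exists_finset hS hfg
  have : ∀ H : F, IsSimpleModule A (M ⧸ H.1) := fun H => isSimpleModule_iff_isCoatom.2 (hF _ H.2)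
  let φ : M →ₗ[A] ∀ H : F, M ⧸ H.1 := LinearMap.pi fun H => H.1.mkQ
  have hφ : ∀ x ∈ S, φ x = 0 → x = 0 := by
    intro x hxS hx
    refine Submodule.disjoint_def.1 hd x hxS ?_
    rw [Submodule.mem_finsetInf]
    intro H hH
    exact (Submodule.Quotient.mk_eq_zero H).1 (congrFun hx ⟨H, hH⟩)
  obtain ⟨C, hC⟩ := ComplementedLattice.exists_isCompl (S.map φ)
  refine ⟨C.comap φ, Submodule.disjoint_def.2 fun x hxS hxC => ?_, ?_⟩
  · exact hφ x hxS (Submodule.disjoint_def.1 hC.disjoint _ (Submodule.mem_map_of_mem hxS) hxC)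
  · rw [codisjoint_iff, eq_top_iff]
    intro x _
    have : φ x ∈ S.map φ ⊔ C := hC.sup_eq_top ▸ Submodule.mem_top
    obtain ⟨_, ⟨s, hs, rfl⟩, c, hc, hsc⟩ := Submodule.mem_sup.1 this
    refine Submodule.mem_sup.2 ⟨s, hs, x - s, ?_, by abel⟩
    rw [Submodule.mem_comap, map_sub, ← hsc, add_sub_cancel_left]
    exact hc

/-- Shock's criterion: if maximal submodules separate and all factor modules have finitely
generated socle, then the module is noetherian. -/
theorem CoatomsSeparate.isNoetherian (h : CoatomsSeparate A M)
    (hfg : ∀ K : Submodule A M, SemisimpleSubmodulesFG A (M ⧸ K)) : IsNoetherian A M := by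
  rw [isNoetherian_iff]
  refine RelEmbedding.wellFounded_iff_isEmpty.2 ⟨fun f => ?_⟩
  have hlt : ∀ n, f n < f (n + 1) := fun n => f.map_rel_iff.2 n.lt_succ_self
  have hmono : Monotone f := (strictMono_nat_of_lt_succ hlt).monotone
  choose x hx hxn using fun n => SetLike.exists_of_lt (hlt n)
  choose H hH hfH hxH using fun n => h (f n) (x n) (hxn n)
  -- Modulo `K` each `f n` embeds in the product of the `M ⧸ H m` with `m < n`, since `f n ≤ H m`
  -- for `m ≥ n`. So the union is semisimple modulo `K`, hence finitely generated, and the chain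
  -- stabilizes there; this forces `x n ∈ f n + K ≤ H n`.
  let K : Submodule A M := (⨆ n, f n) ⊓ ⨅ n, H n
  have hKH : ∀ n, K ≤ H n := fun n => inf_le_right.trans (iInf_le H n)
  have hsimple : ∀ n, IsSimpleModule A (M ⧸ H n) := fun n => isSimpleModule_iff_isCoatom.2 (hH n)
  let Q : ℕ →o Submodule A (M ⧸ K) :=
    ⟨fun n => (f n).map K.mkQ, fun m n hmn => Submodule.map_mono (hmono hmn)⟩
  have hQ : ∀ n, IsSemisimpleModule A (Q n) := by
    intro n
    let φ : M ⧸ K →ₗ[A] ∀ m : Fin n, M ⧸ H m :=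
      LinearMap.pi fun m => K.mapQ (H m) LinearMap.id (hKH m)
    refine .of_injective (φ.comp (Q n).subtype) ((injective_iff_map_eq_zero _).2 ?_)
    rintro ⟨_, y, hy, rfl⟩ hφ
    refine Subtype.ext ((Submodule.Quotient.mk_eq_zero K).2 ⟨Submodule.mem_iSup_of_mem n hy, ?_⟩)
    rw [SetLike.mem_coe, Submodule.mem_iInf]
    intro m
    by_cases hm : m < n
    · exact (Submodule.Quotient.mk_eq_zero (H m)).1 (congrFun hφ ⟨m, hm⟩)
    · exact hfH m (hmono (not_lt.1 hm) hy)
  obtain ⟨n, hn⟩ := (hfg K _ (isSemisimple_iSup hQ)).stabilizes_of_iSup_eq Q rfl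
  have hxQ : K.mkQ (x n) ∈ Q n := by
    rw [← hn]
    exact Submodule.mem_iSup_of_mem (n + 1) (Submodule.mem_map_of_mem (hx n))
  obtain ⟨l, hl, hlx⟩ := hxQ
  have : l - x n ∈ K := by rw [← K.ker_mkQ, LinearMap.mem_ker, map_sub, hlx, sub_self]
  refine hxH n ?_
  rw [← sub_sub_cancel l (x n)]
  exact sub_mem (hfH n hl) (hKH n this)

end Separation

/-! ### Cyclic subfactors and the Osofsky–Smith argument -/

section Subfactors

variable {A : Type u} [Ring A] {M : Type v} [AddCommGroup M] [Module A M]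

/-- Every cyclic subfactor of `M`, presented as an image of `A` by a map that kills the annihilator
of some element of `M`, satisfies (*). -/
def SubfactorsStar (A : Type u) [Ring A] (M : Type v) [AddCommGroup M] [Module A M] : Prop :=
  ∀ (x : M) (Y : Type v) [AddCommGroup Y] [Module A Y] (g : A →ₗ[A] Y),
    Function.Surjective g → (∀ a : A, a • x = 0 → g a = 0) → SatisfiesStar A Y

/-- Every cyclic subfactor of `M` is CS or noetherian. -/
def SubfactorsCSOrNoetherian (A : Type u) [Ring A] (M : Type v) [AddCommGroup M] [Module A M] :
    Prop :=
  ∀ (x : M) (Y : Type v) [AddCommGroup Y] [Module A Y] (g : A →ₗ[A] Y),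
    Function.Surjective g → (∀ a : A, a • x = 0 → g a = 0) → IsCSModule A Y ∨ IsNoetherian A Y

/-- The map `g` factors through the span of `x`, so `Y` is a factor module of that span. Presenting
subfactors by maps from `A` makes passage to submodules and factor modules immediate. -/
theorem CyclicSubfactorsSatisfyStar.subfactorsStar (h : CyclicSubfactorsSatisfyStar A M) :
    SubfactorsStar A M := by
  intro x Y _ _ g hg hx
  let N := Submodule.span A {x}
  let t : A →ₗ[A] N := LinearMap.toSpanSingleton A N ⟨x, Submodule.mem_span_singleton_self x⟩
  have ht : Function.Surjective t := by
    rintro ⟨y, hy⟩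
    obtain ⟨a, rfl⟩ := Submodule.mem_span_singleton.1 hy
    exact ⟨a, rfl⟩
  let K : Submodule A N := (LinearMap.ker g).map t
  have hker : LinearMap.ker (K.mkQ.comp t) = LinearMap.ker g := by
    rw [LinearMap.ker_comp, Submodule.ker_mkQ, Submodule.comap_map_eq, sup_eq_left]
    intro a ha
    exact hx a (congrArg Subtype.val ha)
  have hs : Function.Surjective (K.mkQ.comp t) := K.mkQ_surjective.comp ht
  refine (h N K ?_).congr (((K.mkQ.comp t).quotKerEquivOfSurjective hs).symm.trans
    ((Submodule.quotEquivOfEq _ _ hker).trans (g.quotKerEquivOfSurjective hg)))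
  exact (isCyclicModule_span x).of_surjective K.mkQ K.mkQ_surjective

theorem SubfactorsStar.submodule (h : SubfactorsStar A M) (N : Submodule A M) :
    SubfactorsStar A N := fun x Y _ _ g hg hx =>
  h x Y g hg fun a ha => hx a (Subtype.ext ha)

theorem SubfactorsCSOrNoetherian.quotient (h : SubfactorsCSOrNoetherian A M)
    (K : Submodule A M) : SubfactorsCSOrNoetherian A (M ⧸ K) := by
  intro x Y _ _ g hg hx
  obtain ⟨m, rfl⟩ := K.mkQ_surjective x
  exact h m Y g hg fun a ha => hx a (by rw [← map_smul, ha, map_zero])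

/-- If `E` is essential, a projective factor module of a submodule modulo `E` vanishes. -/
theorem SubfactorsStar.quotient_of_meetsAll (h : SubfactorsStar A M) {E : Submodule A M}
    (hE : MeetsAll E ⊤) : SubfactorsCSOrNoetherian A (M ⧸ E) := by
  intro x Y _ _ g hg hx
  obtain ⟨m, rfl⟩ := E.mkQ_surjective x
  obtain ⟨C, P, hCP, hC, hP⟩ := h m Y g hg fun a ha => hx a (by rw [← map_smul, ha, map_zero])
  obtain ⟨p, hp'⟩ : ∃ p : Y →ₗ[A] P, Function.Surjective p :=
    ⟨P.projectionOnto C hCP.symm, Submodule.projectionOnto_surjective _⟩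
  have hp : Function.Surjective (p.comp g) := hp'.comp hg
  obtain ⟨s, hs⟩ := Module.projective_lifting_property (p.comp g) LinearMap.id hp
  have hs' : ∀ q, p (g (s q)) = q := fun q => LinearMap.congr_fun hs q
  have hgx : ∀ a : A, a • m ∈ E → g a = 0 := fun a ha =>
    hx a (by rw [← map_smul]; exact (Submodule.Quotient.mk_eq_zero E).2 ha)
  have hmem : ∀ q, s q • m ∈ E → q = 0 := by
    intro q hq
    rw [← hs' q, hgx _ hq, map_zero]
  -- The splitting lifts `P` into `M`. By `hmem` the image meets the essential submodule `E`
  -- trivially, so it is zero, and then `P` is zero as well.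
  let t : P →ₗ[A] M := (LinearMap.toSpanSingleton A M m).comp s
  have ht : ∀ q, t q = s q • m := fun _ => rfl
  have hrange : LinearMap.range t = ⊥ := by
    refine hE.eq_bot le_top (Submodule.disjoint_def.2 ?_)
    rintro _ hq ⟨q, rfl⟩
    rw [hmem q hq, map_zero]
  have hP0 : P = ⊥ := by
    rw [Submodule.eq_bot_iff]
    intro y hy
    have h0 : s ⟨y, hy⟩ • m = 0 := by
      rw [← ht, LinearMap.range_eq_bot.1 hrange, LinearMap.zero_apply]
    exact congrArg Subtype.val (hmem ⟨y, hy⟩ (h0 ▸ E.zero_mem))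
  have hC1 : C = ⊤ := by rw [← hCP.sup_eq_top, hP0, sup_bot_eq]
  subst hC1
  refine hC.imp (fun h => h.congr Submodule.topEquiv) fun h => ?_
  have := h
  exact isNoetherian_of_linearEquiv Submodule.topEquiv

theorem SubfactorsCSOrNoetherian.of_cyclic (h : SubfactorsCSOrNoetherian A M)
    (hM : IsCyclicModule A M) : IsCSModule A M ∨ IsNoetherian A M := by
  obtain ⟨x, hx⟩ := hM
  refine h x M (LinearMap.toSpanSingleton A M x) (fun y => ?_) fun a ha => ha
  exact Submodule.mem_span_singleton.1 (hx ▸ Submodule.mem_top)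

theorem SubfactorsCSOrNoetherian.span (h : SubfactorsCSOrNoetherian A M) (x : M) :
    IsCSModule A (Submodule.span A {x}) ∨ IsNoetherian A (Submodule.span A {x}) := by
  refine h x _ (LinearMap.toSpanSingleton A _ ⟨x, Submodule.mem_span_singleton_self x⟩) ?_
    fun a ha => Subtype.ext ha
  rintro ⟨y, hy⟩
  obtain ⟨a, rfl⟩ := Submodule.mem_span_singleton.1 hy
  exact ⟨a, rfl⟩

/-- What matters is finite generation of `D`, inherited as a direct summand: if `S` is not finitely
generated, then `S ≠ D`. -/
theorem IsCSModule.exists_summand (h : IsCSModule A M) [Module.Finite A M] (S : Submodule A M) :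
    ∃ D, S ≤ D ∧ MeetsAll S D ∧ D.FG := by
  obtain ⟨D, L, hDL, hD⟩ := h S
  exact ⟨D, hD.1, hD.meetsAll, fg_of_isCompl hDL⟩

theorem IsCSModule.exists_closure_le {Y : Submodule A M} (h : IsCSModule A Y) (hY : Y.FG)
    {U : Submodule A M} (hU : U ≤ Y) : ∃ G ≤ Y, U ≤ G ∧ MeetsAll U G ∧ G.FG := by
  have : Module.Finite A Y := Module.Finite.iff_fg.2 hY
  obtain ⟨D, hUD, hess, hfg⟩ := h.exists_summand (U.comap Y.subtype)
  refine ⟨D.map Y.subtype, Submodule.map_subtype_le _ _, ?_, ?_, hfg.map _⟩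
  · have := Submodule.map_mono (f := Y.subtype) hUD
    rwa [Submodule.map_comap_subtype, inf_eq_right.2 hU] at this
  · rintro _ ⟨y, hy, rfl⟩ h0
    obtain ⟨a, ha, haU⟩ := hess y hy (by simpa using h0)
    exact ⟨a, fun h => ha (Subtype.ext h), haU⟩

/-- A sequence of independent submodules that are not finitely generated has, in a finitely
generated CS module, proper essential extensions that are again independent. -/
theorem IsCSModule.exists_iSupIndep_summands (h : IsCSModule A M) [Module.Finite A M]
    (hM : ¬ SemisimpleSubmodulesFG A M) :
    ∃ T D : ℕ → Submodule A M, iSupIndep T ∧ iSupIndep D ∧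
      ∀ k, IsSemisimpleModule A (T k) ∧ T k ≤ D k ∧ MeetsAll (T k) (D k) ∧
        ¬ IsSemisimpleModule A (D k) := by
  simp only [SemisimpleSubmodulesFG, not_forall] at hM
  obtain ⟨S, hS, hfg⟩ := hM
  obtain ⟨T, hT, hTS⟩ := exists_iSupIndep_not_fg hS hfg
  choose D hTD hess hD using fun k => h.exists_summand (T k)
  refine ⟨T, D, hT, MeetsAll.iSupIndep hT hess, fun k =>
    ⟨isSemisimple_of_le (hTS k).1 hS, hTD k, hess k, fun hss => (hTS k).2 ?_⟩⟩
  rw [(hess k).eq_of_semisimple (hTD k) hss]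
  exact hD k

/-- Osofsky-Smith type theorem: over separating maximal submodules, a cyclic module whose cyclic
subfactors are CS or noetherian has finitely generated socle. -/
theorem SubfactorsCSOrNoetherian.semisimpleSubmodulesFG (h : SubfactorsCSOrNoetherian A M)
    (hM : IsCyclicModule A M) (hsep : CoatomsSeparate A M) : SemisimpleSubmodulesFG A M := by
  have := hM.finite
  by_contra hnot
  obtain hCS | hN := h.of_cyclic hM
  swap
  · exact hnot .of_isNoetherian
  obtain ⟨T, D, hT, hD, hTD⟩ := hCS.exists_iSupIndep_summands hnot
  choose hTss hTD hess hDss using hTD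
  let S : Submodule A M := ⨆ k, T k
  have hS : IsSemisimpleModule A S := isSemisimple_iSup hTss
  have hSD : S ≤ ⨆ k, D k := iSup_mono hTD
  have hTS : ∀ k, T k ≤ S := le_iSup T
  have hind : iSupIndep fun k => (D k).map S.mkQ :=
    iSupIndep_map_mkQ hD hTD hTS inf_le_left
  have hne : ∀ k, (D k).map S.mkQ ≠ ⊥ := by
    intro k hk
    rw [← LinearMap.le_ker_iff_map, Submodule.ker_mkQ] at hk
    exact hDss k (isSemisimple_of_le hk hS)
  have hQcyc := hM.of_surjective S.mkQ S.mkQ_surjective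
  have hQCS : IsCSModule A (M ⧸ S) := by
    refine ((h.quotient S).of_cyclic hQcyc).resolve_right fun _ => ?_
    exact not_isNoetherian_of_iSupIndep hind hne (N := ⊤) (fun _ => le_top) inferInstance
  -- The summand `D'` is cyclic and contains the images of all `D k`; a lift `y` of its generator
  -- gives a single cyclic submodule `Y` of `M` to work in.
  obtain ⟨D', L', hDL', hD'⟩ := hQCS ((⨆ k, D k).map S.mkQ)
  obtain ⟨y, hy⟩ : ∃ y : M, D' = Submodule.span A {S.mkQ y} := by
    obtain ⟨x, hx⟩ := hQcyc
    obtain ⟨y, hy⟩ := S.mkQ_surjective (D'.projectionOnto L' hDL' x : M ⧸ S)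
    refine ⟨y, ?_⟩
    have h1 : (⊤ : Submodule A (M ⧸ S)).map (D'.subtype.comp (D'.projectionOnto L' hDL')) = D' := by
      rw [Submodule.map_comp, Submodule.map_top, Submodule.range_projectionOnto,
        Submodule.map_subtype_top]
    rw [← h1, ← hx, Submodule.map_span, Set.image_singleton, hy]
    rfl
  let Y := Submodule.span A {y}
  -- If `Y` misses `T k`, it misses the essential extension `D k`. The span of any `z ∈ D k` then
  -- embeds in `M ⧸ Y`, where `z` agrees with an element of `S`; so it is semisimple and lies in `T
  -- k`, making `D k` semisimple.
  have hYT : ∀ k, ¬ Disjoint Y (T k) := by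
    intro k hdis
    have hYD : Disjoint Y (D k) := by
      rw [disjoint_iff]
      refine (hess k).eq_bot inf_le_right ?_
      exact (hdis.symm.mono_right inf_le_left)
    refine hDss k (isSemisimple_of_le (K := T k) (fun z hz => ?_) (hTss k))
    have hzD : S.mkQ z ∈ D' := hD'.1 (Submodule.mem_map_of_mem (Submodule.mem_iSup_of_mem k hz))
    rw [hy] at hzD
    obtain ⟨a, ha⟩ := Submodule.mem_span_singleton.1 hzD
    have hs : z - a • y ∈ S := by
      rw [← S.ker_mkQ, LinearMap.mem_ker, map_sub, map_smul, ha, sub_self]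
    have hzY : Y.mkQ z = Y.mkQ (z - a • y) := by
      rw [map_sub, eq_comm, sub_eq_self]
      exact (Submodule.Quotient.mk_eq_zero Y).2 (Submodule.mem_span_singleton.2 ⟨a, rfl⟩)
    have hss : IsSemisimpleModule A ↥((Submodule.span A {z}).map Y.mkQ) := by
      rw [Submodule.map_span, Set.image_singleton, hzY, ← Set.image_singleton,
        ← Submodule.map_span]
      exact isSemisimple_map (isSemisimple_of_le (by simpa using hs) hS) _
    have hzD' : Submodule.span A {z} ≤ D k := by simpa using hz
    have hzss : IsSemisimpleModule A (Submodule.span A {z}) := by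
      refine .of_injective (Y.mkQ.submoduleMap (Submodule.span A {z}))
        ((injective_iff_map_eq_zero _).2 fun x hx => Subtype.ext ?_)
      have hxY : (x : M) ∈ Y := (Submodule.Quotient.mk_eq_zero Y).1 (congrArg Subtype.val hx)
      exact Submodule.disjoint_def.1 hYD x hxY (hzD' x.2)
    exact ((hess k).mono hzD').le_of_semisimple hzss (Submodule.mem_span_singleton_self z)
  have hu : ∀ k, ∃ u ∈ Y, u ∈ T k ∧ u ≠ 0 := by
    intro k
    have := hYT k
    rw [Submodule.disjoint_def] at this
    push Not at this
    exact this
  choose u huY huT hu0 using hu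
  let U : ℕ → Submodule A M := fun k => Submodule.span A {u k}
  have hUT : ∀ k, U k ≤ T k := fun k => by simpa [U] using huT k
  have hUY : ∀ k, U k ≤ Y := fun k => (Submodule.span_singleton_le_iff_mem _ _).2 (huY k)
  have hU0 : ∀ k, U k ≠ ⊥ := fun k => by simpa [U] using hu0 k
  have hUind : iSupIndep U := hT.mono hUT
  have hYCS : IsCSModule A Y := (h.span y).resolve_right
    (not_isNoetherian_of_iSupIndep hUind hU0 hUY)
  obtain ⟨G, hGY, hUG, hGess, hGfg⟩ := hYCS.exists_closure_le (Submodule.fg_span_singleton y)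
    (iSup_le hUY)
  -- Inside `S`, the finitely generated `G` would be semisimple, hence noetherian, yet it contains
  -- all the `U k`.
  have hGS : ¬ G ≤ S := by
    intro hle
    have : IsSemisimpleModule A G := isSemisimple_of_le hle hS
    have : Module.Finite A G := Module.Finite.iff_fg.2 hGfg
    exact not_isNoetherian_of_iSupIndep hUind hU0 (fun k => (le_iSup U k).trans hUG) inferInstance
  obtain ⟨g₀, hg₀, hg₀S⟩ := SetLike.not_le_iff_exists.1 hGS
  obtain ⟨b, rfl⟩ := Submodule.mem_span_singleton.1 (hGY hg₀)
  have hg₀D : S.mkQ (b • y) ∈ D' := by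
    rw [hy, map_smul]
    exact Submodule.mem_span_singleton.2 ⟨b, rfl⟩
  obtain ⟨a, ha, d, hd, hda⟩ := hD'.meetsAll _ hg₀D fun h0 =>
    hg₀S ((Submodule.Quotient.mk_eq_zero S).1 h0)
  have hgS : a • b • y ∉ S := fun h0 => ha (by
    rw [← map_smul]; exact (Submodule.Quotient.mk_eq_zero S).2 h0)
  have hgD : a • b • y ∈ ⨆ k, D k := by
    have : a • b • y - d ∈ S := by
      rw [← S.ker_mkQ, LinearMap.mem_ker, map_sub, map_smul, hda, sub_self]
    simpa using add_mem (hSD this) hd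
  have hgG : a • b • y ∈ G := G.smul_mem a hg₀
  generalize a • b • y = g at hgS hgD hgG
  obtain ⟨s, hs⟩ := Submodule.mem_iSup_iff_exists_finset.1 hgD
  -- Since `g` involves only the `D i` with `i ∈ s`, any multiple of it in the sum of all `U i`
  -- already lies in the sum over `s`. That finite sum has no proper essential extension, so `g ∈
  -- S`, a contradiction.
  have hUs : MeetsAll (⨆ i ∈ s, U i) (Submodule.span A {g}) := by
    intro x hx hx0
    obtain ⟨a, ha, haU⟩ := hGess x ((Submodule.span_singleton_le_iff_mem _ _).2 hgG hx) hx0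
    refine ⟨a, ha, ?_⟩
    have hxD : a • x ∈ ⨆ i ∈ s, D i :=
      Submodule.smul_mem _ a ((Submodule.span_singleton_le_iff_mem _ _).2 hs hx)
    have hsplit : (⨆ i, U i) ≤ (⨆ i ∈ s, U i) ⊔ ⨆ i ∈ (↑s : Set ℕ)ᶜ, U i := by
      refine iSup_le fun i => ?_
      by_cases hi : i ∈ s
      · exact le_sup_of_le_left (le_iSup₂_of_le i hi le_rfl)
      · exact le_sup_of_le_right
          (le_iSup₂_of_le (f := fun i (_ : i ∈ (↑s : Set ℕ)ᶜ) => U i) i hi le_rfl)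
    obtain ⟨v, hv, w, hw, hvw⟩ := Submodule.mem_sup.1 (hsplit haU)
    have hUD : ∀ i, U i ≤ D i := fun i => (hUT i).trans (hTD i)
    have hdis : Disjoint (⨆ i ∈ (s : Set ℕ), D i) (⨆ i ∈ (↑s : Set ℕ)ᶜ, D i) :=
      hD.disjoint_biSup_biSup disjoint_compl_right
    have hw0 : w = 0 := by
      refine Submodule.disjoint_def.1 hdis w ?_ ((iSup₂_mono fun i _ => hUD i) hw)
      have : w = a • x - v := by rw [← hvw]; abel
      rw [this]
      exact sub_mem hxD ((iSup₂_mono fun i _ => hUD i) hv)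
    rwa [← hvw, hw0, add_zero]
  have hUsS : (⨆ i ∈ s, U i) ≤ S := iSup₂_le fun i _ => (hUT i).trans (hTS i)
  have hle := hsep.le_of_meetsAll (isSemisimple_of_le hUsS hS)
    (Submodule.fg_biSup s U fun i _ => Submodule.fg_span_singleton _) hUs
  exact hgS (hUsS (hle (Submodule.mem_span_singleton_self g)))

theorem SubfactorsCSOrNoetherian.isNoetherian (h : SubfactorsCSOrNoetherian A M)
    (hM : IsCyclicModule A M) (hsep : CoatomsSeparate A M) : IsNoetherian A M :=
  hsep.isNoetherian fun K => (h.quotient K).semisimpleSubmodulesFG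
    (hM.of_surjective K.mkQ K.mkQ_surjective) (hsep.quotient K)

end Subfactors

/-! ### From factors by essential submodules to the factor by the socle -/

section EssentialQuotients

variable {A : Type u} [Ring A] {M : Type v} [AddCommGroup M] [Module A M]

/-- A nonzero submodule without simple submodules has a proper essential submodule. -/
theorem exists_proper_meetsAll {C : Submodule A M} (hC : Disjoint C (socle A M)) (h0 : C ≠ ⊥) :
    ∃ E ≤ C, MeetsAll E C ∧ ¬ C ≤ E := by
  by_contra! hc
  have : IsSemisimpleModule A C := by
    rw [isSemisimpleModule_iff]
    refine ⟨fun B => ?_⟩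
    -- As `C` has no proper essential submodule, `B ⊔ B'` is all of it.
    obtain ⟨B', hB, hess⟩ := exists_disjoint_meetsAll B
    refine ⟨B', hB, ?_⟩
    rw [codisjoint_iff, eq_top_iff]
    have := hc ((B ⊔ B').map C.subtype) (Submodule.map_subtype_le _ _) fun x hx hx0 => by
      obtain ⟨a, ha, haB⟩ := hess ⟨x, hx⟩ trivial fun h => hx0 (congrArg Subtype.val h)
      exact ⟨a, fun h => ha (Subtype.ext h), ⟨_, haB, rfl⟩⟩
    rintro ⟨x, hx⟩ -
    obtain ⟨y, hy, hyx⟩ := this hx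
    exact (Subtype.ext hyx : y = ⟨x, hx⟩) ▸ hy
  exact h0 (hC.eq_bot_of_le (le_socle_iff.2 this))

/-- Every submodule contains an essential direct sum of nonzero finitely generated submodules. -/
theorem exists_sSupIndep_meetsAll (N : Submodule A M) :
    ∃ s : Set (Submodule A M), sSupIndep s ∧ (∀ C ∈ s, C ≤ N ∧ C ≠ ⊥ ∧ C.FG) ∧
      MeetsAll (sSup s) N := by
  obtain ⟨s, hs⟩ := zorn_subset
    {s : Set (Submodule A M) | sSupIndep s ∧ ∀ C ∈ s, C ≤ N ∧ C ≠ ⊥ ∧ C.FG} fun c hc hchain =>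
      ⟨⋃₀ c, ⟨iSupIndep_sUnion_of_directed hchain.directedOn fun s hs => (hc hs).1,
        fun C ⟨s, hsc, hCs⟩ => (hc hsc).2 C hCs⟩, fun _ => Set.subset_sUnion_of_mem⟩
  refine ⟨s, hs.prop.1, hs.prop.2, fun x hx hx0 => ?_⟩
  by_contra! hcon
  let C := Submodule.span A {x}
  have hCs : Disjoint C (sSup s) := by
    rw [Submodule.disjoint_def]
    intro y hy hys
    obtain ⟨a, rfl⟩ := Submodule.mem_span_singleton.1 hy
    by_contra h0
    exact hcon a h0 hys
  have hC0 : C ≠ ⊥ := by simpa [C] using hx0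
  have hmem : insert C s ⊆ s := by
    refine hs.le_of_ge (y := insert C s) ⟨?_, ?_⟩ (Set.subset_insert C s)
    · intro D hD
      rcases hD with rfl | hD
      · exact hCs.mono_right (sSup_le_sSup (by simp))
      · have h1 : insert C s \ {D} ⊆ insert C (s \ {D}) := by
          rintro E ⟨rfl | hE, hED⟩
          · exact Or.inl rfl
          · exact Or.inr ⟨hE, hED⟩
        refine Disjoint.mono_right (sSup_le_sSup h1) ?_
        rw [sSup_insert, sup_comm]
        refine (hs.prop.1 hD).disjoint_sup_right_of_disjoint_sup_left (hCs.symm.mono_left ?_)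
        exact sup_le (le_sSup hD) (sSup_le_sSup Set.sdiff_subset)
    · rintro D (rfl | hD)
      · exact ⟨by simpa [C] using hx, hC0, Submodule.fg_span_singleton x⟩
      · exact hs.prop.2 D hD
  exact hC0 (hCs.eq_bot_of_le (le_sSup (hmem (Set.mem_insert C s))))

theorem inf_iSup_le_of_iSupIndep {ι : Type*} {S D : ι → Submodule A M} (hD : iSupIndep D)
    (hSD : ∀ i, S i ≤ D i) (i : ι) : D i ⊓ ⨆ j, S j ≤ S i := by
  have hsplit : (⨆ j, S j) ≤ S i ⊔ ⨆ (j) (_ : j ≠ i), S j := by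
    refine iSup_le fun j => ?_
    by_cases hj : j = i
    · subst hj; exact le_sup_left
    · exact le_sup_of_le_right (le_iSup₂_of_le j hj le_rfl)
  rintro z ⟨hz, hzS⟩
  obtain ⟨s, hs, s', hs', rfl⟩ := Submodule.mem_sup.1 (hsplit hzS)
  have h1 : s' ∈ D i := by simpa using sub_mem hz (hSD i hs)
  have h2 : s' = 0 := Submodule.disjoint_def.1 (hD i) _ h1 ((iSup₂_mono fun j _ => hSD j) hs')
  rwa [h2, add_zero]

/-- Take an essential direct sum of finitely generated `C` in `N`, each with a proper essential `E
C`. Infinitely many `C` would give infinitely many independent nonzero images modulo an essential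
submodule containing the `E C`. So the sum is finitely generated, and `N` modulo it embeds in a
noetherian factor of `M`. -/
theorem fg_of_disjoint_socle (h : ∀ E : Submodule A M, MeetsAll E ⊤ → IsNoetherian A (M ⧸ E))
    {N : Submodule A M} (hN : Disjoint N (socle A M)) : N.FG := by
  obtain ⟨s, hs, hsN, hess⟩ := exists_sSupIndep_meetsAll N
  have hsfin : Finite s := by
    by_contra hinf
    rw [not_finite_iff_infinite] at hinf
    choose E hEC hE hCE using fun C : s =>
      exists_proper_meetsAll (hN.mono_left (hsN C C.2).1) (hsN C C.2).2.1
    have hC : iSupIndep fun C : s => C.1 := (sSupIndep_iff s).1 hs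
    have hEind : iSupIndep E := hC.mono hEC
    obtain ⟨N', hdis, hN'⟩ := exists_disjoint_meetsAll (⨆ C, E C)
    have := h _ hN'
    have hinf : ((⨆ C, E C) ⊔ N') ⊓ ⨆ C : s, C.1 ≤ ⨆ C, E C := by
      rw [sup_inf_assoc_of_le _ (iSup_mono hEC)]
      rw [(MeetsAll.iSup hEind hE).eq_bot inf_le_right (hdis.mono_right inf_le_left), sup_bot_eq]
    refine not_isNoetherian_of_iSupIndep (N := ⊤) (iSupIndep_map_mkQ hC hEC
      (fun C => (le_iSup E C).trans le_sup_left) hinf) (fun C hC0 => ?_) (fun _ => le_top)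
      inferInstance
    rw [← LinearMap.le_ker_iff_map, Submodule.ker_mkQ] at hC0
    refine hCE C (le_trans (le_inf le_rfl ?_) (inf_iSup_le_of_iSupIndep hC hEC C))
    exact le_trans (le_inf hC0 (le_iSup (fun C : s => C.1) C)) hinf
  obtain ⟨N', hdis, hN'⟩ := exists_disjoint_meetsAll (sSup s)
  have := h _ hN'
  refine Submodule.fg_of_fg_map_of_fg_inf_ker (sSup s ⊔ N').mkQ (IsNoetherian.noetherian _) ?_
  rw [Submodule.ker_mkQ, inf_comm, sup_inf_assoc_of_le _ (sSup_le fun C hC => (hsN C hC).1),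
    hess.eq_bot inf_le_right (hdis.mono_right inf_le_left), sup_bot_eq, sSup_eq_iSup']
  exact Submodule.fg_iSup _ fun C => (hsN C C.2).2.2

/-- A maximal `K` disjoint from the socle is noetherian by `fg_of_disjoint_socle`, and `socle A M ⊔
K` is essential. So `M ⧸ socle A M` is an extension of a noetherian module by an image of `K`. -/
theorem isNoetherian_quotient_socle
    (h : ∀ E : Submodule A M, MeetsAll E ⊤ → IsNoetherian A (M ⧸ E)) :
    IsNoetherian A (M ⧸ socle A M) := by
  obtain ⟨K, hdis, hK⟩ := exists_disjoint_meetsAll (socle A M)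
  have := h _ hK
  have hKn : IsNoetherian A K := isNoetherian_submodule.2 fun N hN =>
    fg_of_disjoint_socle h (hdis.symm.mono_left hN)
  let g : M ⧸ socle A M →ₗ[A] M ⧸ (socle A M ⊔ K) := Submodule.factor le_sup_left
  refine ⟨fun N => Submodule.fg_of_fg_map_of_fg_inf_ker g (IsNoetherian.noetherian _) ?_⟩
  have hker : LinearMap.ker g ≤ K.map (socle A M).mkQ := by
    intro x hx
    obtain ⟨m, rfl⟩ := (socle A M).mkQ_surjective x
    have : m ∈ socle A M ⊔ K := (Submodule.Quotient.mk_eq_zero _).1 hx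
    obtain ⟨s, hs, k, hk, rfl⟩ := Submodule.mem_sup.1 this
    refine ⟨k, hk, ?_⟩
    rw [map_add, right_eq_add]
    exact (Submodule.Quotient.mk_eq_zero _).2 hs
  have : IsNoetherian A (K.map (socle A M).mkQ) :=
    isNoetherian_of_surjective ((socle A M).mkQ.submoduleMap K)
      (LinearMap.range_eq_top.2 (LinearMap.submoduleMap_surjective _ _))
  exact Submodule.FG.of_le_of_isNoetherian (inf_le_right.trans hker)

end EssentialQuotients

/-! ### Finite generation of the socle by repeated splitting -/

section Splitting

variable {A : Type u} [Ring A] {M : Type v} [AddCommGroup M] [Module A M]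
variable {M' : Type w} [AddCommGroup M'] [Module A M']

theorem map_socle_le (f : M →ₗ[A] M') : (socle A M).map f ≤ socle A M' :=
  le_socle_iff.2 (isSemisimple_map isSemisimple_socle f)

theorem isNoetherian_quotient_socle_of_surjective [IsNoetherian A (M ⧸ socle A M)]
    (f : M →ₗ[A] M') (hf : Function.Surjective f) : IsNoetherian A (M' ⧸ socle A M') := by
  refine isNoetherian_of_surjective
    ((socle A M).mapQ (socle A M') f (Submodule.map_le_iff_le_comap.1 (map_socle_le f))) ?_
  rw [LinearMap.range_eq_top]
  intro y
  obtain ⟨y, rfl⟩ := (socle A M').mkQ_surjective y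
  obtain ⟨x, rfl⟩ := hf y
  exact ⟨(socle A M).mkQ x, rfl⟩

/-- Otherwise there are independent non-semisimple `D k` with essential semisimple `T k`. The socle
meets their sum in the sum of the `T k`, so the images of the `D k` modulo the socle are independent
and nonzero. -/
theorem IsCSModule.semisimpleSubmodulesFG (h : IsCSModule A M) [Module.Finite A M]
    [IsNoetherian A (M ⧸ socle A M)] : SemisimpleSubmodulesFG A M := by
  by_contra hnot
  obtain ⟨T, D, hT, hD, hTD⟩ := h.exists_iSupIndep_summands hnot
  choose hTss hTD hess hDss using hTD
  refine not_isNoetherian_of_iSupIndep (N := ⊤) (iSupIndep_map_mkQ hD hTD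
    (fun k => le_socle_iff.2 (hTss k)) (E := socle A M) ?_) (fun k hk => ?_) (fun _ => le_top)
    inferInstance
  · exact ((MeetsAll.iSup hT hess).mono inf_le_right).le_of_semisimple
      (isSemisimple_of_le inf_le_left isSemisimple_socle)
  · rw [← LinearMap.le_ker_iff_map, Submodule.ker_mkQ] at hk
    exact hDss k (le_socle_iff.1 hk)

theorem SemisimpleSubmodulesFG.fg_of_le {N S : Submodule A M} (h : SemisimpleSubmodulesFG A N)
    (hSN : S ≤ N) (hS : IsSemisimpleModule A S) : S.FG := by
  have h1 : IsSemisimpleModule A ↥(S.comap N.subtype) :=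
    (Submodule.comapSubtypeEquivOfLe hSN).isSemisimpleModule_iff.2 hS
  have h2 := (h _ h1).map N.subtype
  rwa [Submodule.map_comap_subtype, inf_eq_right.2 hSN] at h2

theorem isCompl_ker_range {P : Type*} [AddCommGroup P] [Module A P] {f : M →ₗ[A] P}
    {s : P →ₗ[A] M} (h : ∀ q, f (s q) = q) : IsCompl (LinearMap.ker f) (LinearMap.range s) := by
  constructor
  · rw [Submodule.disjoint_def]
    rintro _ hx ⟨q, rfl⟩
    rw [LinearMap.mem_ker, h] at hx
    rw [hx, map_zero]
  · rw [codisjoint_iff, eq_top_iff]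
    intro x _
    refine Submodule.mem_sup.2 ⟨x - s (f x), ?_, s (f x), ⟨_, rfl⟩, sub_add_cancel _ _⟩
    rw [LinearMap.mem_ker, map_sub, h, sub_self]

/-- Apply (*) to `M ⧸ T 0` and lift its projective summand `P` to a summand of `M`. The kernel of `M
→ P` contains `T 0`. Semisimple submodules of `C` are finitely generated; were this so for the lift
of `P`, it would hold for `M ⧸ T 0`, into which `T 1` embeds. -/
theorem SubfactorsStar.exists_isCompl (h : SubfactorsStar A M) (hM : IsCyclicModule A M)
    [IsNoetherian A (M ⧸ socle A M)] (hnot : ¬ SemisimpleSubmodulesFG A M) :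
    ∃ K₁ K₂ : Submodule A M, IsCompl K₁ K₂ ∧ ¬ SemisimpleSubmodulesFG A K₁ ∧
      ¬ SemisimpleSubmodulesFG A K₂ := by
  simp only [SemisimpleSubmodulesFG, not_forall] at hnot
  obtain ⟨S, hS, hfg⟩ := hnot
  obtain ⟨T, hT, hTS⟩ := exists_iSupIndep_not_fg hS hfg
  have hss : ∀ k, IsSemisimpleModule A (T k) := fun k => isSemisimple_of_le (hTS k).1 hS
  have hdis : Disjoint (T 1) (T 0) := hT.pairwiseDisjoint one_ne_zero
  have hstar : SatisfiesStar A (M ⧸ T 0) := by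
    obtain ⟨x, hx⟩ := hM
    refine h x _ ((T 0).mkQ.comp (LinearMap.toSpanSingleton A M x)) ?_ fun a ha => ?_
    · refine (T 0).mkQ_surjective.comp fun y => ?_
      exact Submodule.mem_span_singleton.1 (hx ▸ Submodule.mem_top)
    · rw [LinearMap.comp_apply, LinearMap.toSpanSingleton_apply, ha, map_zero]
  obtain ⟨C, P, hCP, hC, hP⟩ := hstar
  obtain ⟨p, hp, hpker⟩ : ∃ p : (M ⧸ T 0) →ₗ[A] P, Function.Surjective p ∧ LinearMap.ker p = C :=
    ⟨P.projectionOnto C hCP.symm, Submodule.projectionOnto_surjective _,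
      Submodule.ker_projectionOnto _⟩
  obtain ⟨q, hq⟩ : ∃ q : (M ⧸ T 0) →ₗ[A] C, Function.Surjective q :=
    ⟨C.projectionOnto P hCP, Submodule.projectionOnto_surjective _⟩
  have hCss : SemisimpleSubmodulesFG A C := by
    have hs : Function.Surjective (q.comp (T 0).mkQ) := hq.comp (T 0).mkQ_surjective
    obtain hC | hC := hC
    · have := (hM.of_surjective _ hs).finite
      have := isNoetherian_quotient_socle_of_surjective _ hs
      exact hC.semisimpleSubmodulesFG
    · exact .of_isNoetherian
  obtain ⟨s, hs⟩ := Module.projective_lifting_property (p.comp (T 0).mkQ) LinearMap.id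
    (hp.comp (T 0).mkQ_surjective)
  have hs' : ∀ q, p.comp (T 0).mkQ (s q) = q := fun q => LinearMap.congr_fun hs q
  refine ⟨_, _, isCompl_ker_range hs', fun h1 => ?_, fun h2 => ?_⟩
  · refine (hTS 0).2 (h1.fg_of_le (fun x hx => ?_) (hss 0))
    rw [LinearMap.mem_ker, LinearMap.comp_apply, Submodule.mkQ_apply,
      (Submodule.Quotient.mk_eq_zero _).2 hx, map_zero]
  · have hPss : SemisimpleSubmodulesFG A P := h2.of_injective s.rangeRestrict fun x y hxy => by
      have := congrArg Subtype.val hxy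
      rw [← hs' x, ← hs' y]
      exact congrArg _ this
    have hY : SemisimpleSubmodulesFG A (M ⧸ T 0) := .of_ker p hPss (hpker ▸ hCss)
    refine (hTS 1).2 (Submodule.fg_of_fg_map_of_fg_inf_ker (T 0).mkQ
      (hY _ (isSemisimple_map (hss 1) _)) ?_)
    rw [Submodule.ker_mkQ, hdis.eq_bot]
    exact Submodule.fg_bot

theorem SubfactorsStar.semisimpleSubmodulesFG (h : SubfactorsStar A M) (hM : IsCyclicModule A M)
    [hnoeth : IsNoetherian A (M ⧸ socle A M)] : SemisimpleSubmodulesFG A M := by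
  by_contra hnot
  -- Choose `K ⊕ P` with the image of `P` modulo the socle maximal and split `K` again. Moving `K₂`
  -- over to `P` cannot enlarge that image, so `K₂` lies in the socle; being a summand of a cyclic
  -- module, it is finitely generated.
  obtain ⟨Q, ⟨K, P, hKP, hK, rfl⟩, hmax⟩ := set_has_maximal_iff_noetherian.2 hnoeth
    {Q | ∃ K P : Submodule A M, IsCompl K P ∧ ¬ SemisimpleSubmodulesFG A K ∧
      P.map (socle A M).mkQ = Q}
    ⟨_, ⊤, ⊥, isCompl_top_bot, fun h => hnot (h.of_injective Submodule.topEquiv.symm.toLinearMap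
      Submodule.topEquiv.symm.injective), rfl⟩
  obtain ⟨q, hq, hqK, hqP⟩ : ∃ q : M →ₗ[A] K, Function.Surjective q ∧ (∀ x : K, q x = x) ∧
      ∀ x ∈ P, q x = 0 :=
    ⟨K.projectionOnto P hKP, Submodule.projectionOnto_surjective _,
      Submodule.projectionOnto_apply_left hKP,
      fun x hx => (Submodule.projectionOnto_apply_eq_zero_iff hKP).2 hx⟩
  have hKcyc := hM.of_surjective q hq
  have := hKcyc.finite
  have := isNoetherian_quotient_socle_of_surjective q hq
  obtain ⟨K₁, K₂, hK₁₂, hK₁, hK₂⟩ := (h.submodule K).exists_isCompl hKcyc hK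
  have hcompl : IsCompl (K₁.map K.subtype) (K₂.map K.subtype ⊔ P) := by
    constructor
    · rw [Submodule.disjoint_def]
      rintro _ ⟨x, hx, rfl⟩ hx'
      obtain ⟨_, ⟨y, hy, rfl⟩, z, hz, hyz⟩ := Submodule.mem_sup.1 hx'
      have := congrArg q hyz
      simp only [Submodule.subtype_apply, map_add, hqK, hqP z hz, add_zero] at this
      rw [Submodule.disjoint_def.1 hK₁₂.disjoint x hx (this ▸ hy), map_zero]
    · rw [codisjoint_iff, ← sup_assoc, ← Submodule.map_sup, hK₁₂.sup_eq_top,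
        Submodule.map_subtype_top, hKP.sup_eq_top]
  have hle : (P.map (socle A M).mkQ) ≤ (K₂.map K.subtype ⊔ P).map (socle A M).mkQ :=
    Submodule.map_mono le_sup_right
  have heq := hle.eq_of_not_lt (hmax _ ⟨_, _, hcompl, fun h => hK₁ (h.of_injective
    (K.subtype.submoduleMap K₁) (Submodule.equivMapOfInjective _ K.injective_subtype K₁).injective),
    rfl⟩)
  refine hK₂ ?_
  have hss : K₂ ≤ socle A K := by
    intro x hx
    have hx' : (socle A M).mkQ x ∈ P.map (socle A M).mkQ :=
      heq ▸ Submodule.mem_map_of_mem (Submodule.mem_sup_left ⟨x, hx, rfl⟩)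
    obtain ⟨z, hz, hzx⟩ := hx'
    have hs : (x : M) - z ∈ socle A M := by
      rw [← (socle A M).ker_mkQ, LinearMap.mem_ker, map_sub, hzx, sub_self]
    have : q (x - z) = x := by rw [map_sub, hqK, hqP z hz, sub_zero]
    exact this ▸ map_socle_le q ⟨_, hs, rfl⟩
  have : IsSemisimpleModule A K₂ := le_socle_iff.1 hss
  have : Module.Finite A K₂ := Module.Finite.iff_fg.2 (fg_of_isCompl hK₁₂.symm)
  exact .of_isNoetherian

/-- A cyclic module whose cyclic subfactors satisfy (*) is noetherian if maximal submodules
separate in its factor modules by essential submodules. -/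
theorem SubfactorsStar.isNoetherian (h : SubfactorsStar A M) (hM : IsCyclicModule A M)
    (hsep : ∀ E : Submodule A M, MeetsAll E ⊤ → CoatomsSeparate A (M ⧸ E)) :
    IsNoetherian A M := by
  have hE : ∀ E : Submodule A M, MeetsAll E ⊤ → IsNoetherian A (M ⧸ E) := fun E hE =>
    (h.quotient_of_meetsAll hE).isNoetherian (hM.of_surjective E.mkQ E.mkQ_surjective) (hsep E hE)
  have := isNoetherian_quotient_socle hE
  rw [isNoetherian_iff_submodule_quotient (socle A M)]
  have hss : IsSemisimpleModule A (socle A M) := isSemisimple_socle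
  have : Module.Finite A (socle A M) :=
    Module.Finite.iff_fg.2 (h.semisimpleSubmodulesFG hM _ hss)
  exact ⟨inferInstance, inferInstance⟩

end Splitting

/-! ### V-rings and WV-rings; the noetherian conclusions -/

section Injectivity

/-- If all simple modules are `M`-injective, maximal submodules of `M` separate. -/
theorem CoatomsSeparate.of_isInjectiveRelativeTo {A : Type u} [Ring A] {M : Type v}
    [AddCommGroup M] [Module A M]
    (h : ∀ (Q : Type u) [AddCommGroup Q] [Module A Q], IsSimpleModule A Q →
      IsInjectiveRelativeTo A M Q) : CoatomsSeparate A M := by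
  intro N x hx
  let I : Submodule A A := N.comap (LinearMap.toSpanSingleton A M x)
  have hI : I ≠ ⊤ := fun hI => hx (by
    have : (1 : A) ∈ I := hI ▸ Submodule.mem_top
    simpa [I] using this)
  obtain ⟨m, hm, hIm⟩ := Ideal.exists_le_maximal I hI
  have hQ : IsSimpleModule A (A ⧸ m) := isSimpleModule_iff_isCoatom.2 hm.out
  -- On the range of `φ`, which is `A • x + N`, the map `ψ` induces a homomorphism to `A ⧸ m`
  -- killing `N` but not `x`. The kernel of its extension to `M` is the maximal submodule sought.
  let φ : (A × N) →ₗ[A] M := (LinearMap.toSpanSingleton A M x).coprod N.subtype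
  let ψ : (A × N) →ₗ[A] A ⧸ m := (Submodule.mkQ m).comp (LinearMap.fst A A N)
  have hφ : ∀ z, φ z = z.1 • x + z.2 := fun _ => rfl
  have hker : LinearMap.ker φ ≤ LinearMap.ker ψ := by
    intro z hz
    have hz' : z.1 • x + z.2 = 0 := hz
    refine (Submodule.Quotient.mk_eq_zero m).2 (hIm ?_)
    change z.1 • x ∈ N
    rw [eq_neg_of_add_eq_zero_left hz']
    exact neg_mem z.2.2
  obtain ⟨g, hg⟩ := h (A ⧸ m) hQ (LinearMap.range φ)
    (((LinearMap.ker φ).liftQ ψ hker).comp φ.quotKerEquivRange.symm.toLinearMap)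
  have hgφ : ∀ z, g (φ z) = ψ z := by
    intro z
    rw [hg ⟨φ z, LinearMap.mem_range_self φ z⟩, LinearMap.comp_apply, LinearEquiv.coe_coe,
      LinearMap.quotKerEquivRange_symm_apply_image, Submodule.mkQ_apply, Submodule.liftQ_apply]
  have hgN : ∀ n ∈ N, g n = 0 := by
    intro n hn
    have := hgφ (0, ⟨n, hn⟩)
    rwa [hφ, zero_smul, zero_add, LinearMap.comp_apply, LinearMap.fst_apply, map_zero] at this
  have hgx : g x ≠ 0 := by
    have := hgφ (1, 0)
    rw [hφ, one_smul, Submodule.coe_zero, add_zero] at this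
    rw [this]
    exact fun h0 => hm.ne_top ((Ideal.eq_top_iff_one m).2 ((Submodule.Quotient.mk_eq_zero m).1 h0))
  have hg0 : g ≠ 0 := fun h0 => hgx (by rw [h0, LinearMap.zero_apply])
  exact ⟨LinearMap.ker g, LinearMap.isCoatom_ker_of_surjective (LinearMap.surjective_of_ne_zero hg0),
    hgN, hgx⟩

variable {R : Type u} [Ring R]

theorem IsRightVRing.coatomsSeparate (hR : IsRightVRing R) (M : Type v) [AddCommGroup M]
    [Module Rᵐᵒᵖ M] : CoatomsSeparate Rᵐᵒᵖ M := by
  refine .of_isInjectiveRelativeTo fun Q _ _ hQ N f => ?_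
  have := hR Q hQ
  obtain ⟨g, hg⟩ := Module.Injective.extension_property Rᵐᵒᵖ Q N M N.subtype N.injective_subtype f
  exact ⟨g, fun x => LinearMap.congr_fun hg x⟩

/-- Left multiplication as a map of right modules. -/
def leftMul (a : R) : R →ₗ[Rᵐᵒᵖ] R where
  toFun x := a * x
  map_add' := mul_add a
  map_smul' r x := (mul_assoc a x r.unop).symm

@[simp]
theorem leftMul_apply (a x : R) : leftMul a x = a * x := rfl

theorem isCyclicModule_self : IsCyclicModule Rᵐᵒᵖ R := by
  refine ⟨1, eq_top_iff.2 fun r _ => Submodule.mem_span_singleton.2 ⟨MulOpposite.op r, ?_⟩⟩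
  rw [op_smul_eq_mul, one_mul]

/-- The excluded case `R ⧸ I ≅ R` is degenerate: the projection would split, and the image of the
splitting would miss the essential `I`, so `R` would be zero. -/
theorem IsRightWVRing.coatomsSeparate (hR : IsRightWVRing R) {I : Submodule Rᵐᵒᵖ R}
    (hI : MeetsAll I ⊤) : CoatomsSeparate Rᵐᵒᵖ (R ⧸ I) := by
  by_cases he : IsEmpty ((R ⧸ I) ≃ₗ[Rᵐᵒᵖ] R)
  · exact .of_isInjectiveRelativeTo fun Q _ _ hQ => hR Q hQ I he
  obtain ⟨e⟩ := not_isEmpty_iff.1 he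
  let f : R →ₗ[Rᵐᵒᵖ] R := e.toLinearMap.comp I.mkQ
  obtain ⟨z, hz⟩ : ∃ z, f z = 1 := (e.surjective.comp I.mkQ_surjective) 1
  have hfz : ∀ r, f (z * r) = r := fun r => by
    rw [← op_smul_eq_mul, map_smul, hz, op_smul_eq_mul, one_mul]
  have hrange : LinearMap.range (leftMul z) = ⊥ := by
    refine hI.eq_bot le_top (Submodule.disjoint_def.2 ?_)
    rintro _ hx ⟨r, rfl⟩
    rw [leftMul_apply] at hx ⊢
    have : f (z * r) = 0 := by
      change e (I.mkQ (z * r)) = 0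
      rw [Submodule.mkQ_apply, (Submodule.Quotient.mk_eq_zero I).2 hx, map_zero]
    rw [hfz] at this
    rw [this, mul_zero]
  have hr : ∀ r : R, r = 0 := fun r => by
    have : z * r = 0 := LinearMap.congr_fun (LinearMap.range_eq_bot.1 hrange) r
    rw [← hfz r, this, map_zero]
  intro N x hx
  obtain ⟨r, rfl⟩ := I.mkQ_surjective x
  rw [hr r, map_zero] at hx
  exact absurd N.zero_mem hx

theorem CyclicRightModulesSatisfyStar.subfactorsStar (h : CyclicRightModulesSatisfyStar R) :
    SubfactorsStar Rᵐᵒᵖ R := by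
  intro _ Y _ _ g hg _
  refine h Y ?_
  have : IsCyclicModule Rᵐᵒᵖ Rᵐᵒᵖ :=
    ⟨1, eq_top_iff.2 fun r _ => Submodule.mem_span_singleton.2 ⟨r, by simp⟩⟩
  exact this.of_surjective g hg

theorem SatisfiesStar.of_isNoetherian {A : Type u} [Ring A] {M : Type v} [AddCommGroup M]
    [Module A M] [IsNoetherian A M] : SatisfiesStar A M :=
  ⟨⊤, ⊥, isCompl_top_bot, .inr inferInstance, inferInstance⟩

/-- A right WV-ring is right noetherian if and only if its cyclic right modules satisfy (*). -/
theorem IsRightWVRing.isNoetherian_iff (hR : IsRightWVRing R) :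
    IsNoetherian Rᵐᵒᵖ R ↔ CyclicRightModulesSatisfyStar R := by
  refine ⟨fun _ N _ _ hN => ?_, fun h => ?_⟩
  · obtain ⟨x, hx⟩ := hN
    have : Function.Surjective (LinearMap.toSpanSingleton Rᵐᵒᵖ N x) := fun y =>
      Submodule.mem_span_singleton.1 (hx ▸ Submodule.mem_top)
    let f : R →ₗ[Rᵐᵒᵖ] N :=
      { toFun := fun r => MulOpposite.op r • x
        map_add' := fun r s => by rw [MulOpposite.op_add, add_smul]
        map_smul' := fun r s => by
          rw [RingHom.id_apply, ← mul_smul]; rfl }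
    have : IsNoetherian Rᵐᵒᵖ N := isNoetherian_of_surjective f <| LinearMap.range_eq_top.2 fun y => by
      obtain ⟨r, hr⟩ := this y
      exact ⟨r.unop, hr⟩
    exact .of_isNoetherian
  · exact h.subfactorsStar.isNoetherian isCyclicModule_self fun _ => hR.coatomsSeparate

theorem IsRightVRing.isNoetherian_of_finite (hR : IsRightVRing R) {M : Type v} [AddCommGroup M]
    [Module Rᵐᵒᵖ M] [Module.Finite Rᵐᵒᵖ M] (h : SubfactorsStar Rᵐᵒᵖ M) :
    IsNoetherian Rᵐᵒᵖ M := by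
  obtain ⟨s, hs⟩ := Module.Finite.fg_top (R := Rᵐᵒᵖ) (M := M)
  have : ∀ x : s, IsNoetherian Rᵐᵒᵖ (Submodule.span Rᵐᵒᵖ {(x : M)}) := fun x =>
    (h.submodule _).isNoetherian (isCyclicModule_span _) fun _ _ => hR.coatomsSeparate _
  rw [← isNoetherian_top_iff, ← hs, Submodule.span_eq_iSup_of_singleton_spans, iSup_subtype']
  exact isNoetherian_iSup

theorem socle_eq_bot_of_disjoint {A : Type u} [Ring A] {M : Type v} [AddCommGroup M] [Module A M]
    {T : Submodule A M} (hT : Disjoint (socle A M) T) : socle A T = ⊥ := by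
  refine Submodule.map_injective_of_injective T.injective_subtype ?_
  rw [Submodule.map_bot]
  exact le_bot_iff.1 (hT (map_socle_le T.subtype) (Submodule.map_subtype_le _ _))

theorem IsRightVRing.exists_isCompl_socle (hR : IsRightVRing R) (M : Type v) [AddCommGroup M]
    [Module Rᵐᵒᵖ M] [IsNoetherian Rᵐᵒᵖ M] :
    ∃ X T : Submodule Rᵐᵒᵖ M, IsCompl X T ∧ IsSemisimpleModule Rᵐᵒᵖ X ∧
      IsNoetherian Rᵐᵒᵖ T ∧ socle Rᵐᵒᵖ T = ⊥ := by
  obtain ⟨T, hT⟩ := (hR.coatomsSeparate M).exists_isCompl (isSemisimple_socle (A := Rᵐᵒᵖ) (M := M))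
    (IsNoetherian.noetherian _)
  exact ⟨_, T, hT, isSemisimple_socle, inferInstance, socle_eq_bot_of_disjoint hT.disjoint⟩

end Injectivity

/-! ### Two-sided ideals and central idempotents -/

section RingDecomposition

variable {R : Type u} [Ring R]

/-- A maximal right ideal `H ≥ N` omitting `a` would give `1 = y + a * r` with `y ∈ H`, whence `a =
y * a + a * r * a ∈ H`. With `N = ⊥` this is semiprimeness; with `N = a * I` it gives `a ∈ a * I`
for `a` in an ideal `I`. -/
theorem CoatomsSeparate.mem_of_forall_mul_mul_mem (h : CoatomsSeparate Rᵐᵒᵖ R) {a : R}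
    {N : Submodule Rᵐᵒᵖ R} (ha : ∀ r, a * r * a ∈ N) : a ∈ N := by
  by_contra haN
  obtain ⟨H, hH, hNH, haH⟩ := h N a haN
  have htop : H ⊔ LinearMap.range (leftMul a) = ⊤ := by
    refine hH.2 _ (lt_of_le_of_ne le_sup_left fun heq => haH ?_)
    rw [heq]
    exact Submodule.mem_sup_right ⟨1, mul_one a⟩
  obtain ⟨y, hy, _, ⟨r, rfl⟩, hyr⟩ := Submodule.mem_sup.1 (htop ▸ Submodule.mem_top (x := (1 : R)))
  rw [leftMul_apply] at hyr
  apply haH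
  rw [← one_mul a, ← hyr, add_mul]
  exact add_mem (H.smul_mem (MulOpposite.op a) hy) (hNH (ha r))

/-- A two-sided ideal as a right ideal. -/
def rightIdeal (I : TwoSidedIdeal R) : Submodule Rᵐᵒᵖ R where
  carrier := {x | x ∈ I}
  add_mem' := I.add_mem
  zero_mem' := I.zero_mem
  smul_mem' r x hx := I.mul_mem_right x r.unop hx

@[simp]
theorem mem_rightIdeal {I : TwoSidedIdeal R} {x : R} : x ∈ rightIdeal I ↔ x ∈ I := Iff.rfl

theorem rightIdeal_strictMono : StrictMono (rightIdeal : TwoSidedIdeal R → Submodule Rᵐᵒᵖ R) :=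
  Monotone.strictMono_of_injective (fun _ _ h x hx => h hx) fun I J h => by
    ext x
    rw [← mem_rightIdeal, h, mem_rightIdeal]

theorem CoatomsSeparate.exists_mul_eq (h : CoatomsSeparate Rᵐᵒᵖ R) (I : TwoSidedIdeal R)
    (F : Finset R) (hF : ∀ a ∈ F, a ∈ I) : ∃ e ∈ I, ∀ a ∈ F, a * e = a := by
  classical
  induction F using Finset.induction_on with
  | empty => exact ⟨0, I.zero_mem, by simp⟩
  | insert b F hb ih =>
    obtain ⟨e, he, heF⟩ := ih fun a ha => hF a (Finset.mem_insert_of_mem ha)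
    have hbI : b ∈ I := hF b (Finset.mem_insert_self b F)
    have hc : b - b * e ∈ I := I.sub_mem hbI (I.mul_mem_left _ _ he)
    obtain ⟨f, hf, hbf⟩ : b - b * e ∈ (rightIdeal I).map (leftMul (b - b * e)) := by
      refine h.mem_of_forall_mul_mul_mem fun r => ⟨r * (b - b * e), ?_, ?_⟩
      · exact I.mul_mem_left _ _ hc
      · rw [leftMul_apply, mul_assoc]
    -- One minus this element is `(1 - e) * (1 - f)`: the first factor annihilates `F`, and the
    -- product annihilates `b`.
    refine ⟨e + f - e * f, I.sub_mem (I.add_mem he hf) (I.mul_mem_left _ _ hf), fun a ha => ?_⟩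
    rcases Finset.mem_insert.1 ha with rfl | ha
    · rw [leftMul_apply, sub_mul, mul_assoc] at hbf
      rw [mul_sub, mul_add, add_sub_assoc, hbf, add_sub_cancel]
    · rw [mul_sub, mul_add, ← mul_assoc, heF a ha, add_sub_cancel_right]

/-- In a two-sided ideal, the right annihilator of some finite subset vanishes. -/
theorem CoatomsSeparate.exists_finset_annihilator (h : CoatomsSeparate Rᵐᵒᵖ R)
    [hR : IsNoetherian Rᵐᵒᵖ R] (I : TwoSidedIdeal R) :
    ∃ F : Finset R, (∀ a ∈ F, a ∈ I) ∧ ∀ x ∈ I, (∀ a ∈ F, a * x = 0) → x = 0 := by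
  classical
  obtain ⟨X, ⟨F, hF, hFX⟩, hX⟩ := set_has_maximal_iff_noetherian.2 hR
    {X | ∃ F : Finset R, (∀ a ∈ F, a ∈ I) ∧ ∀ x ∈ X, (∀ a ∈ F, a * x = 0) → x = 0}
    ⟨⊥, ∅, by simp, by simp⟩
  refine ⟨F, hF, fun y hy hFy => ?_⟩
  by_contra hy0
  -- With the right annihilator of `b` maximal, a nonzero `b * r * b` has the same one. Adding `b *
  -- r` to `F` therefore allows `X` to be enlarged by the right ideal generated by `b`.
  obtain ⟨_, ⟨b, ⟨hb, hFb, hb0⟩, rfl⟩, hmax⟩ := set_has_maximal_iff_noetherian.2 hR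
    ((fun b => LinearMap.ker (leftMul b)) '' {b : R | b ∈ I ∧ (∀ a ∈ F, a * b = 0) ∧ b ≠ 0})
    ⟨_, y, ⟨hy, hFy, hy0⟩, rfl⟩
  obtain ⟨r, hr⟩ : ∃ r, b * r * b ≠ 0 := by
    by_contra! hc
    exact hb0 ((Submodule.mem_bot Rᵐᵒᵖ).1
      (h.mem_of_forall_mul_mul_mem fun r => (Submodule.mem_bot Rᵐᵒᵖ).2 (hc r)))
  have hker : LinearMap.ker (leftMul b) = LinearMap.ker (leftMul (b * r * b)) := by
    refine LE.le.eq_of_not_lt (fun x hx => ?_) (hmax _ ⟨_, ⟨I.mul_mem_left _ _ hb, ?_, hr⟩, rfl⟩)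
    · rw [LinearMap.mem_ker, leftMul_apply] at hx ⊢
      rw [mul_assoc, hx, mul_zero]
    · intro a ha
      rw [← mul_assoc, ← mul_assoc, hFb a ha, zero_mul, zero_mul]
  refine hX (X ⊔ LinearMap.range (leftMul b)) ⟨insert (b * r) F, ?_, ?_⟩ ?_
  · intro a ha
    rcases Finset.mem_insert.1 ha with rfl | ha
    · exact I.mul_mem_right _ _ hb
    · exact hF a ha
  · intro z hz hzF
    obtain ⟨x, hx, _, ⟨s, rfl⟩, rfl⟩ := Submodule.mem_sup.1 hz
    rw [leftMul_apply] at hzF ⊢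
    have hx0 : x = 0 := by
      refine hFX x hx fun a ha => ?_
      have := hzF a (Finset.mem_insert_of_mem ha)
      rwa [mul_add, ← mul_assoc, hFb a ha, zero_mul, add_zero] at this
    have hs : s ∈ LinearMap.ker (leftMul (b * r * b)) := by
      have := hzF _ (Finset.mem_insert_self _ _)
      rwa [hx0, zero_add, ← mul_assoc] at this
    rw [← hker, LinearMap.mem_ker, leftMul_apply] at hs
    rw [hx0, hs, zero_add]
  · refine lt_of_le_of_ne le_sup_left fun heq => hb0 (hFX b ?_ hFb)
    rw [heq]
    exact Submodule.mem_sup_right ⟨1, mul_one b⟩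

/-- Over a right noetherian right V-ring, two-sided ideals are generated by central idempotents. -/
theorem CoatomsSeparate.exists_central (h : CoatomsSeparate Rᵐᵒᵖ R) [IsNoetherian Rᵐᵒᵖ R]
    (I : TwoSidedIdeal R) : ∃ e ∈ I, (∀ r, e * r = r * e) ∧ ∀ y ∈ I, e * y = y := by
  obtain ⟨F, hF, hFI⟩ := h.exists_finset_annihilator I
  obtain ⟨e, he, heF⟩ := h.exists_mul_eq I F hF
  have hey : ∀ y ∈ I, e * y = y := by
    intro y hy
    refine (sub_eq_zero.1 (hFI (y - e * y) (I.sub_mem hy (I.mul_mem_left _ _ hy)) ?_)).symm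
    intro a ha
    rw [mul_sub, ← mul_assoc, heF a ha, sub_self]
  refine ⟨e, he, fun r => ?_, hey⟩
  -- This element `x` has `x * e = 0`, and `e` is a left identity on `I`, so `x * s * x = x * e * s
  -- * x = 0`; semiprimeness applies.
  have h0 : e * r - e * r * e = 0 := by
    refine (Submodule.mem_bot Rᵐᵒᵖ).1 (h.mem_of_forall_mul_mul_mem fun s => ?_)
    have h1 : e * (s * (e * r - e * r * e)) = s * (e * r - e * r * e) := by
      refine hey _ (I.mul_mem_left _ _ (I.sub_mem (I.mul_mem_right _ _ he) (I.mul_mem_left _ _ he)))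
    rw [Submodule.mem_bot, mul_assoc, sub_mul, mul_assoc (e * r) e, h1, sub_self]
  rw [sub_eq_zero.1 h0, mul_assoc]
  exact hey _ (I.mul_mem_left _ _ he)

/-- Elements annihilated on the left by a two-sided ideal. -/
def rightAnnihilator (I : TwoSidedIdeal R) : Submodule Rᵐᵒᵖ R where
  carrier := {x | ∀ y ∈ I, y * x = 0}
  add_mem' hx hx' y hy := by rw [mul_add, hx y hy, hx' y hy, add_zero]
  zero_mem' y _ := mul_zero y
  smul_mem' r x hx y hy := by
    change y * (x * r.unop) = 0
    rw [← mul_assoc, hx y hy, zero_mul]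

/-- Choose `F` with the annihilator of its intersection maximal, and let the central idempotent `e`
generate that intersection. If `e ≠ 0`, some maximal `m` contains the annihilator of `e`, hence `1 -
e`, and so omits `e`. Adjoining `m` leaves the annihilator unchanged, so the new idempotent `e'`
satisfies `e = e * e' ∈ m`. -/
theorem CoatomsSeparate.exists_finset_inf_eq_bot (h : CoatomsSeparate Rᵐᵒᵖ R)
    [hR : IsNoetherian Rᵐᵒᵖ R] :
    ∃ F : Finset (TwoSidedIdeal R), (∀ m ∈ F, IsCoatom m) ∧ F.inf id = ⊥ := by
  classical
  have : WellFoundedGT (TwoSidedIdeal R) := rightIdeal_strictMono.wellFoundedGT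
  obtain ⟨_, ⟨F, hF, rfl⟩, hmax⟩ := set_has_maximal_iff_noetherian.2 hR
    ((fun F : Finset (TwoSidedIdeal R) => rightAnnihilator (F.inf id)) ''
      {F | ∀ m ∈ F, IsCoatom m}) ⟨_, ∅, by simp, rfl⟩
  refine ⟨F, hF, ?_⟩
  obtain ⟨e, he, hcen, hid⟩ := h.exists_central (F.inf id)
  by_contra hne
  have he0 : e ≠ 0 := by
    rintro rfl
    refine hne (eq_bot_iff.2 fun y hy => ?_)
    rw [TwoSidedIdeal.mem_bot, ← hid y hy, zero_mul]
  let K : TwoSidedIdeal R := .mk' {x | e * x = 0} (mul_zero e)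
    (fun {x y} (hx : e * x = 0) (hy : e * y = 0) => by
      change e * (x + y) = 0; rw [mul_add, hx, hy, add_zero])
    (fun {x} (hx : e * x = 0) => by change e * -x = 0; rw [mul_neg, hx, neg_zero])
    (fun {x y} (hy : e * y = 0) => by
      change e * (x * y) = 0; rw [← mul_assoc, hcen, mul_assoc, hy, mul_zero])
    (fun {x y} (hx : e * x = 0) => by change e * (x * y) = 0; rw [← mul_assoc, hx, zero_mul])
  have hK : ∀ x, x ∈ K ↔ e * x = 0 := fun x => TwoSidedIdeal.mem_mk' ..
  have hKtop : K ≠ ⊤ := fun hK' => he0 (by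
    have : (1 : R) ∈ K := hK' ▸ TwoSidedIdeal.mem_top _
    rwa [hK, mul_one] at this)
  obtain ⟨m, hm, hKm⟩ := (eq_top_or_exists_le_coatom K).resolve_left hKtop
  have hem : e ∉ m := by
    intro hem
    have : 1 - e ∈ m := hKm ((hK _).2 (by rw [mul_sub, mul_one, hid e he, sub_self]))
    exact hm.1 (m.one_mem_iff.1 (by simpa using m.add_mem this hem))
  have hle : (insert m F).inf id ≤ F.inf id := Finset.inf_mono (Finset.subset_insert m F)
  obtain ⟨e', he', hcen', hid'⟩ := h.exists_central ((insert m F).inf id)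
  have heq : rightAnnihilator (F.inf id) = rightAnnihilator ((insert m F).inf id) := by
    refine LE.le.eq_of_not_lt (fun x hx y hy => hx y (hle hy)) (hmax _ ⟨_, ?_, rfl⟩)
    simpa using ⟨hm, hF⟩
  have hmem : 1 - e' ∈ rightAnnihilator ((insert m F).inf id) := by
    intro y hy
    rw [mul_sub, mul_one, ← hcen', hid' y hy, sub_self]
  rw [← heq] at hmem
  have hee : e * (1 - e') = 0 := hmem e he
  rw [mul_sub, mul_one, sub_eq_zero] at hee
  apply hem
  rw [hee]
  refine m.mul_mem_left _ _ ?_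
  rw [Finset.inf_insert] at he'
  exact ((TwoSidedIdeal.mem_inf _).1 he').1

end RingDecomposition

/-! ### Factor rings by maximal two-sided ideals -/

section SimpleQuotients

variable {R : Type u} [Ring R]

/-- `R` as a right module over itself is `Rᵐᵒᵖ` as a left module over itself. -/
def opEquiv (R : Type u) [Ring R] : R ≃ₗ[Rᵐᵒᵖ] Rᵐᵒᵖ where
  __ := MulOpposite.opEquiv
  map_add' _ _ := rfl
  map_smul' _ _ := rfl

theorem isNoetherian_quotient [IsNoetherian Rᵐᵒᵖ R] (m : Ideal R) [m.IsTwoSided] :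
    IsNoetherian (R ⧸ m)ᵐᵒᵖ (R ⧸ m) := by
  have : IsNoetherianRing Rᵐᵒᵖ := isNoetherian_of_linearEquiv (opEquiv R)
  have : IsNoetherianRing (R ⧸ m)ᵐᵒᵖ :=
    isNoetherianRing_of_surjective _ _ (Ideal.Quotient.mk m).op fun x => by
      obtain ⟨y, hy⟩ := Ideal.Quotient.mk_surjective x.unop
      exact ⟨MulOpposite.op y, MulOpposite.unop_injective hy⟩
  exact isNoetherian_of_linearEquiv (opEquiv (R ⧸ m)).symm

theorem isSimpleRing_quotient {m : TwoSidedIdeal R} (hm : IsCoatom m) :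
    IsSimpleRing (R ⧸ m.asIdeal) := by
  have h1 : (1 : R) ∉ m := fun h => hm.1 (m.one_mem_iff.1 h)
  have : Nontrivial (R ⧸ m.asIdeal) := by
    refine ⟨1, 0, fun h => h1 ?_⟩
    rwa [← map_one (Ideal.Quotient.mk m.asIdeal), Ideal.Quotient.eq_zero_iff_mem,
      TwoSidedIdeal.mem_asIdeal] at h
  refine ⟨⟨fun J => ?_⟩⟩
  let J' : TwoSidedIdeal R := J.comap (Ideal.Quotient.mk m.asIdeal)
  have hJ' : ∀ x, x ∈ J' ↔ Ideal.Quotient.mk m.asIdeal x ∈ J := fun x => TwoSidedIdeal.mem_comap _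
  have hmJ : m ≤ J' := fun x hx => by
    rw [hJ', Ideal.Quotient.eq_zero_iff_mem.2 (TwoSidedIdeal.mem_asIdeal.2 hx)]
    exact J.zero_mem
  obtain h | h := hm.le_iff.1 hmJ
  · right
    rw [← J.one_mem_iff, ← map_one (Ideal.Quotient.mk m.asIdeal), ← hJ', h]
    exact TwoSidedIdeal.mem_top _
  · left
    refine eq_bot_iff.2 fun x hx => ?_
    obtain ⟨x, rfl⟩ := Ideal.Quotient.mk_surjective x
    rw [TwoSidedIdeal.mem_bot, Ideal.Quotient.eq_zero_iff_mem, TwoSidedIdeal.mem_asIdeal, ← h]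
    exact (hJ' x).2 hx

/-- A simple ring with nonzero right socle is semisimple. -/
theorem isSemisimpleRing_of_socle_ne_bot [IsSimpleRing R] (h : socle Rᵐᵒᵖ R ≠ ⊥) :
    IsSemisimpleRing R := by
  -- The right socle is two-sided because left multiplications are right linear and so preserve it.
  let J : TwoSidedIdeal R := .mk' (socle Rᵐᵒᵖ R) (zero_mem _) add_mem neg_mem
    (fun {x y} hy => map_socle_le (leftMul x) ⟨y, hy, rfl⟩)
    (fun {x y} hx => (socle Rᵐᵒᵖ R).smul_mem (MulOpposite.op y) hx)
  have hJ : ∀ x, x ∈ J ↔ x ∈ socle Rᵐᵒᵖ R := fun x => TwoSidedIdeal.mem_mk' ..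
  obtain hJ0 | hJ1 := eq_bot_or_eq_top J
  · refine absurd (eq_bot_iff.2 fun x hx => ?_) h
    rw [Submodule.mem_bot, ← TwoSidedIdeal.mem_bot, ← hJ0, hJ]
    exact hx
  · have htop : ⊤ ≤ socle Rᵐᵒᵖ R := fun x _ => (hJ x).1 (hJ1 ▸ TwoSidedIdeal.mem_top _)
    have := le_socle_iff.1 htop
    have : IsSemisimpleModule Rᵐᵒᵖ R := Submodule.topEquiv.isSemisimpleModule_iff.1 this
    exact isSemisimpleRing_mulOpposite_iff.1 ((opEquiv R).isSemisimpleModule_iff.1 this)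

end SimpleQuotients

/-! ### Chinese remainder decomposition -/

section RingDecomposition

variable {R : Type u} [Ring R]

/-- Over a right noetherian right V-ring, the maximal two-sided ideals of a finite set with zero
intersection decompose the ring. -/
theorem CoatomsSeparate.exists_ringEquiv (h : CoatomsSeparate Rᵐᵒᵖ R) [IsNoetherian Rᵐᵒᵖ R] :
    ∃ F : Finset (TwoSidedIdeal R), (∀ m ∈ F, IsCoatom m) ∧
      Nonempty (R ≃+* ∀ m : F, R ⧸ m.1.asIdeal) := by
  obtain ⟨F, hF, hinf⟩ := h.exists_finset_inf_eq_bot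
  refine ⟨F, hF, ⟨RingEquiv.ofBijective
    (RingHom.pi fun m : F => Ideal.Quotient.mk m.1.asIdeal) ⟨?_, fun g => ?_⟩⟩⟩
  · refine (injective_iff_map_eq_zero _).2 fun x hx => ?_
    have hle : TwoSidedIdeal.span {x} ≤ F.inf id := by
      refine Finset.le_inf fun m hm => TwoSidedIdeal.span_le.2 (Set.singleton_subset_iff.2 ?_)
      exact TwoSidedIdeal.mem_asIdeal.1 (Ideal.Quotient.eq_zero_iff_mem.1 (congrFun hx ⟨m, hm⟩))
    rw [hinf] at hle
    exact TwoSidedIdeal.mem_bot _ |>.1 (hle (TwoSidedIdeal.subset_span rfl))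
  · choose e he hcen hid using fun m : F => h.exists_central m.1
    choose r hr using fun m : F => Ideal.Quotient.mk_surjective (g m)
    -- `1 - e m` annihilates `m`, and `m` and `m'` are comaximal. Being also `1` modulo `m`, these
    -- elements solve the congruences.
    have hmem : ∀ m m' : F, m ≠ m' → 1 - e m ∈ m'.1 := by
      intro m m' hne
      have hsup : m.1 ⊔ m'.1 = ⊤ := by
        refine (hF m m.2).2 _ (lt_of_le_of_ne le_sup_left fun heq => hne (Subtype.ext ?_))
        have hle : m'.1 ≤ m.1 := le_sup_right.trans heq.ge
        exact ((hF m' m'.2).le_iff.1 hle).resolve_left (hF m m.2).1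
      have h1 : (1 : R) ∈ m.1 ⊔ m'.1 := hsup ▸ TwoSidedIdeal.mem_top _
      obtain ⟨a, ha, b, hb, hab⟩ := TwoSidedIdeal.mem_sup.1 h1
      have : 1 - e m = (1 - e m) * b := by
        have h0 : (1 - e m) * a = 0 := by rw [sub_mul, one_mul, hid m a ha, sub_self]
        rw [← zero_add ((1 - e m) * b), ← h0, ← mul_add, hab, mul_one]
      rw [this]
      exact m'.1.mul_mem_left _ _ hb
    refine ⟨∑ m, r m * (1 - e m), funext fun m' => ?_⟩
    rw [RingHom.pi_apply, map_sum, Finset.sum_eq_single m']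
    · rw [map_mul, map_sub, map_one, hr,
        Ideal.Quotient.eq_zero_iff_mem.2 (TwoSidedIdeal.mem_asIdeal.2 (he m')), sub_zero, mul_one]
    · intro m _ hne
      rw [map_mul, Ideal.Quotient.eq_zero_iff_mem.2 (TwoSidedIdeal.mem_asIdeal.2 (hmem m m' hne)),
        mul_zero]
    · exact fun hm => absurd (Finset.mem_univ _) hm

/-- The simple factors are sorted by their right socle: those where it is nonzero are semisimple and
together form `S`. -/
theorem CoatomsSeparate.exists_ringEquiv_prod (h : CoatomsSeparate Rᵐᵒᵖ R)
    [IsNoetherian Rᵐᵒᵖ R] :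
    ∃ (S : Type u) (_ : Ring S) (n : ℕ) (T : Fin n → Type u) (_ : ∀ i, Ring (T i)),
      Nonempty (R ≃+* S × (∀ i, T i)) ∧ IsSemisimpleRing S ∧
      ∀ i, IsSimpleRing (T i) ∧ IsNoetherian (T i)ᵐᵒᵖ (T i) ∧ socle (T i)ᵐᵒᵖ (T i) = ⊥ := by
  classical
  obtain ⟨F, hF, ⟨φ⟩⟩ := h.exists_ringEquiv
  let Q : F → Type u := fun m => R ⧸ m.1.asIdeal
  let p : F → Prop := fun m => socle (Q m)ᵐᵒᵖ (Q m) ≠ ⊥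
  have hsimple : ∀ m : F, IsSimpleRing (Q m) := fun m => isSimpleRing_quotient (hF m m.2)
  have hss : ∀ m : {m // p m}, IsSemisimpleRing (Q m.1) := fun m =>
    isSemisimpleRing_of_socle_ne_bot m.2
  let ε := Finite.equivFin {m // ¬ p m}
  refine ⟨∀ m : {m // p m}, Q m.1, inferInstance, _, fun i => Q (ε.symm i).1, inferInstance,
    ⟨φ.trans ((RingEquiv.piEquivPiSubtypeProd p Q).trans
      ((RingEquiv.refl _).prodCongr (RingEquiv.piCongrLeft' _ ε)))⟩, inferInstance,
    fun i => ⟨hsimple _, isNoetherian_quotient _, not_not.1 (ε.symm i).2⟩⟩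

end RingDecomposition
end RightMod

theorem theorem18 (R : Type u) [Ring R] :
    (RightMod.IsRightVRing R →
      ∀ (M : Type v) [AddCommGroup M] [Module Rᵐᵒᵖ M],
        Module.Finite Rᵐᵒᵖ M →
        Module.Projective Rᵐᵒᵖ (RightMod.socle Rᵐᵒᵖ M) →
        RightMod.CyclicSubfactorsSatisfyStar Rᵐᵒᵖ M →
          IsNoetherian Rᵐᵒᵖ M ∧
          ∃ X T : Submodule Rᵐᵒᵖ M, IsCompl X T ∧ IsSemisimpleModule Rᵐᵒᵖ X ∧
            IsNoetherian Rᵐᵒᵖ T ∧ RightMod.socle Rᵐᵒᵖ T = ⊥) ∧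
    (RightMod.IsRightVRing R → RightMod.CyclicRightModulesSatisfyStar R →
      ∃ (S : Type u) (_ : Ring S) (n : ℕ) (T : Fin n → Type u) (_ : ∀ i, Ring (T i)),
        Nonempty (R ≃+* S × (∀ i, T i)) ∧ IsSemisimpleRing S ∧
        ∀ i, IsSimpleRing (T i) ∧ IsNoetherian (T i)ᵐᵒᵖ (T i) ∧
          RightMod.socle (T i)ᵐᵒᵖ (T i) = ⊥) ∧
    (RightMod.IsRightWVRing R →
      (IsNoetherian Rᵐᵒᵖ R ↔ RightMod.CyclicRightModulesSatisfyStar R)) := by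
  refine ⟨fun hR M _ _ _ _ h => ?_, fun hR h => ?_, fun hR => hR.isNoetherian_iff⟩
  · have := hR.isNoetherian_of_finite h.subfactorsStar
    exact ⟨this, hR.exists_isCompl_socle M⟩
  · have : Module.Finite Rᵐᵒᵖ R := RightMod.isCyclicModule_self.finite
    have := hR.isNoetherian_of_finite h.subfactorsStar
    exact (hR.coatomsSeparate R).exists_ringEquiv_prod
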